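/- There is an absolute constant $C$ such that the following two statements hold. All graphs are finite, simple and undirected (not necessarily connected), with non-negative integer edge weights. An $\alpha$-spanner of a weighted graph $G$ is a subgraph $H$ with the inherited weights such that $d_H(u,v)\le\alpha\, d_G(u,v)$ for all nodes $u,v$, where $d$ denotes the weighted distance ($\infty$ if $u,v$ are not connected). Its size is its number of edges. (1) *Broadcast congested clique.* For all $c,d\in\mathbb{N}$ there is $b\in\mathbb{N}$ such that for all $n$ and all integers $k\ge 1$ there is a deterministic algorithm in the broadcast congested clique on $n$ nodes with messages of $b\lceil\log_2 n\rceil$ bits with the following property. For every $n$-node graph $G$ with edge weights at most $n^c$, and every assignment of distinct identifiers from $\{0,\dots,n^d-1\}$ to the nodes, after at most $C\,k\,n^{1/k}\log n$ rounds every node outputs one and the same complete weighted edge set of a $(2k-1)$-spanner of $G$ of size at most $C\,k\,n^{1+1/k}$. Here each node initially knows $n$, $k$, its own identifier, and the identifiers of its neighbours with the weights of its incident edges; in each synchronous round every node broadcasts one message, which all nodes receive together with the identifier of the sender; local computation is arbitrary. (2) *Multipass streaming.* For every $c\in\mathbb{N}$ there is $b\in\mathbb{N}$ such that for all $n$ and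 all integers $k\ge1$ there is a deterministic streaming algorithm whose memory consists of at most $C\,(k+\log n)\,n^{1+1/k}$ words of $b\lceil\log_2 n\rceil$ bits each and which, for every graph $G$ on the node set $\{0,\dots,n-1\}$ with edge weights at most $n^c$, and every stream that lists each weighted edge of $G$ exactly once, in arbitrary order, outputs after $k$ passes over the stream the weighted edge set of a $(2k-1)$-spanner of $G$ of size at most $C\,k\,n^{1+1/k}$. The algorithm knows $n$ and $k$; its memory is what it keeps from one stream item to the next, and the computation on each item is arbitrary. -/

import Mathlib

noncomputable section

namespace DistSpanner

/-! ## Weighted graphs and spanners -/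

/-- Weighted distance: the least total weight of a walk from `u` to `v`
(`⊤` if there is none). -/
def wdist {V : Type} (G : SimpleGraph V) (w : Sym2 V → ℕ) (u v : V) : ℕ∞ :=
  ⨅ p : G.Walk u v, (((p.edges.map w).sum : ℕ) : ℕ∞)

/-- `H` is an `α`-spanner of the weighted graph `(G, w)`: a subgraph, with the inherited weights,
in which distances exceed those of `G` by a factor of at most `α`. -/
def IsSpanner {V : Type} (α : ℕ) (G : SimpleGraph V) (w : Sym2 V → ℕ) (H : SimpleGraph V) : Prop :=
  H ≤ G ∧ ∀ u v : V, wdist H w u v ≤ (α : ℕ∞) * wdist G w u v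

/-! ## The broadcast congested clique -/

/-- What a node knows initially about the graph: its own identifier, and for each incident edge
the identifier of the other endpoint together with the weight of the edge. -/
structure LocalInput where
  ident : ℕ
  incident : Set (ℕ × ℕ)

/-- The local input of node `v`, when node `u` carries the identifier `ident u`. -/
def localInput {n : ℕ} (G : SimpleGraph (Fin n)) (w : Sym2 (Fin n) → ℕ) (ident : Fin n → ℕ)
    (v : Fin n) : LocalInput where
  ident := ident v
  incident := {x | ∃ u, G.Adj v u ∧ x = (ident u, w s(v, u))}

/-- A deterministic algorithm for the broadcast congested clique with messages of `β` bits, whose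
nodes compute a set of weighted edges (given by the identifiers of their endpoints). All nodes run
the same code. In every round each node broadcasts one message that depends on its state, and then
updates its state from the messages broadcast in that round, each of which arrives together with
the identifier of its sender. Local computation is arbitrary. -/
structure BCCAlgorithm (β : ℕ) where
  State : Type
  init : LocalInput → State
  send : State → (Fin β → Bool)
  receive : State → Set (ℕ × (Fin β → Bool)) → State
  output : State → Set (Sym2 ℕ × ℕ)

/-- The state of every node after `t` rounds. -/
def BCCAlgorithm.run {β : ℕ} (A : BCCAlgorithm β) {n : ℕ} (G : SimpleGraph (Fin n))
    (w : Sym2 (Fin n) → ℕ) (ident : Fin n → ℕ) : ℕ → Fin n → A.State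
  | 0, v => A.init (localInput G w ident v)
  | t + 1, v => A.receive (A.run G w ident t v)
      (Set.range fun u => (ident u, A.send (A.run G w ident t u)))

/-- The weighted edges of `(H, w)`, in terms of node identifiers. -/
def identEdges {n : ℕ} (H : SimpleGraph (Fin n)) (w : Sym2 (Fin n) → ℕ) (ident : Fin n → ℕ) :
    Set (Sym2 ℕ × ℕ) :=
  {x | ∃ e ∈ H.edgeSet, x = (e.map ident, w e)}

/-! ## Multipass streaming -/

/-- A memory of `S` words of `β` bits each. -/
abbrev Memory (S β : ℕ) : Type := Fin S → Fin β → Bool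

/-- A deterministic multipass streaming algorithm on graphs with vertex set `Fin n` whose memory
consists of `S` words of `β` bits: it updates its memory on each weighted edge of the stream and
at the end of each pass, and it computes a set of weighted edges from its final memory. -/
structure StreamingAlgorithm (n S β : ℕ) where
  init : Memory S β
  step : Memory S β → Sym2 (Fin n) × ℕ → Memory S β
  endPass : Memory S β → Memory S β
  output : Memory S β → Set (Sym2 (Fin n) × ℕ)

/-- The memory after `p` passes over the stream. -/
def StreamingAlgorithm.run {n S β : ℕ} (A : StreamingAlgorithm n S β)
    (stream : List (Sym2 (Fin n) × ℕ)) : ℕ → Memory S β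
  | 0 => A.init
  | p + 1 => A.endPass (stream.foldl A.step (A.run stream p))

/-- The weighted edges of `(H, w)`. -/
def weightedEdges {n : ℕ} (H : SimpleGraph (Fin n)) (w : Sym2 (Fin n) → ℕ) :
    Set (Sym2 (Fin n) × ℕ) :=
  {x | ∃ e ∈ H.edgeSet, x = (e, w e)}

/-- `stream` lists every weighted edge of `(G, w)` exactly once, in an arbitrary order. -/
def IsEdgeStream {n : ℕ} (G : SimpleGraph (Fin n)) (w : Sym2 (Fin n) → ℕ)
    (stream : List (Sym2 (Fin n) × ℕ)) : Prop :=
  stream.Nodup ∧ ∀ x, x ∈ stream ↔ x ∈ weightedEdges G w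

end DistSpanner

end

/-!
This is a derandomized Baswana–Sen clustering. Nodes are grouped into clusters, whose members are
joined to a center by short paths of light spanner edges. In each of `k` phases a `1 / s` fraction
of the clusters is sampled, where `s` is about `n ^ (1 / k)`. Every node scans its lightest edges
to the neighbouring clusters in increasing order, adds them up to the first one that leads to a
sampled cluster, and joins that cluster. After `k` phases no cluster is left, and an edge discarded
in phase `t` has a detour of `2 * t + 1` spanner edges none of which is heavier.

A node only needs its lightest edges to the `q` nearest clusters, with `q` about `s * log n`: by a
first moment computation some sample meets all lists of this length, has few clusters, and causes
few edges to be added. In the clique all nodes see all lists and so agree on the same good sample,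
and since lists of lightest edges are mergeable, a streaming pass can update them edge by edge.
-/

namespace DistSpanner

open Set
open scoped Finset

/-! ## The lightest items of distinct clusters -/

section Lightest

variable {α κ : Type*} [LinearOrder α] {cl : α → κ} {q : ℕ} {J K N : Set α} {a b : α}

/-- The lightest item of each of the `q` clusters of `J` nearest to the node that holds the
items `J`, where `cl a` is the cluster to which the item `a` leads. -/
def lightest (cl : α → κ) (q : ℕ) (J : Set α) : Set α :=
  {a ∈ J | (∀ b ∈ J, cl b = cl a → a ≤ b) ∧ (cl '' (J ∩ Iio a)).encard < q}

theorem lightest_subset : lightest cl q J ⊆ J := fun _ h => h.1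

theorem injOn_lightest : InjOn cl (lightest cl q J) := fun _ ha _ hb h =>
  le_antisymm (ha.2.1 _ hb.1 h.symm) (hb.2.1 _ ha.1 h)

theorem encard_image_inter_Iio_mono (hKJ : K ⊆ J) (hab : a ≤ b) :
    (cl '' (K ∩ Iio a)).encard ≤ (cl '' (J ∩ Iio b)).encard :=
  encard_mono (image_mono (inter_subset_inter hKJ (Iio_subset_Iio hab)))

theorem encard_lightest_le : (lightest cl q J).encard ≤ q := by
  by_contra! h
  obtain ⟨T, hT, hcard⟩ := exists_subset_encard_eq (Order.add_one_le_of_lt h)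
  have hne : T.Nonempty := one_le_encard_iff_nonempty.1 (hcard ▸ le_add_self)
  obtain ⟨a, ha, hmax⟩ := exists_max_image T id (finite_of_encard_eq_coe (k := q + 1) hcard) hne
  have hprefix : (T \ {a}).encard ≤ (cl '' (J ∩ Iio a)).encard := by
    rw [← ((injOn_lightest.mono hT).mono sdiff_subset).encard_image]
    exact encard_mono (image_mono fun b hb => ⟨(hT hb.1).1, (hmax b hb.1).lt_of_ne hb.2⟩)
  have hq : (T \ {a}).encard = q := by
    rw [← encard_sdiff_singleton_add_one ha] at hcard
    exact WithTop.add_right_cancel ENat.one_ne_top hcard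
  exact (hq ▸ hprefix).not_gt (hT ha).2.2

variable [WellFoundedLT α]

theorem exists_least_of_cluster (cl : α → κ) (hb : b ∈ J) :
    ∃ a ∈ J, cl a = cl b ∧ a ≤ b ∧ ∀ x ∈ J, cl x = cl a → a ≤ x := by
  obtain ⟨a, ⟨haJ, hab⟩, hmin⟩ :=
    wellFounded_lt.has_min {x ∈ J | cl x = cl b} ⟨b, hb, rfl⟩
  exact ⟨a, haJ, hab, not_lt.1 (hmin b ⟨hb, rfl⟩),
    fun x hx hxa => not_lt.1 (hmin x ⟨hx, hxa.trans hab⟩)⟩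

theorem le_encard_lightest_of_notMem (ha : a ∈ J) (hleast : ∀ x ∈ J, cl x = cl a → a ≤ x)
    (hnot : a ∉ lightest cl q J) : (q : ℕ∞) ≤ (lightest cl q J).encard := by
  obtain ⟨m, ⟨hmJ, hm, hmL⟩, hmin⟩ := wellFounded_lt.has_min
    {x ∈ J | (∀ y ∈ J, cl y = cl x → x ≤ y) ∧ x ∉ lightest cl q J} ⟨a, ha, hleast, hnot⟩
  have hclusters : cl '' (J ∩ Iio m) ⊆ cl '' lightest cl q J := by
    rintro _ ⟨y, ⟨hy, hym⟩, rfl⟩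
    obtain ⟨z, hz, hzy, hle, hzleast⟩ := exists_least_of_cluster cl hy
    exact ⟨z, by_contra fun hzL => hmin z ⟨hz, hzleast, hzL⟩ (hle.trans_lt hym), hzy⟩
  calc (q : ℕ∞) ≤ (cl '' (J ∩ Iio m)).encard := not_lt.1 fun h => hmL ⟨hmJ, hm, h⟩
    _ ≤ (cl '' lightest cl q J).encard := encard_mono hclusters
    _ ≤ (lightest cl q J).encard := encard_image_le _ _

theorem exists_mem_lightest_le_or_forall_lt (hb : b ∈ J) :
    (∃ z ∈ lightest cl q J, cl z = cl b ∧ z ≤ b) ∨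
      (q : ℕ∞) ≤ (lightest cl q J).encard ∧ ∀ a ∈ lightest cl q J, a < b := by
  obtain ⟨m, hmJ, hmb, hle, hleast⟩ := exists_least_of_cluster cl hb
  by_cases hm : m ∈ lightest cl q J
  · exact .inl ⟨m, hm, hmb, hle⟩
  · refine .inr ⟨le_encard_lightest_of_notMem hmJ hleast hm, fun a ha => not_le.1 fun hba => hm ?_⟩
    exact ⟨hmJ, hleast,
      (encard_image_inter_Iio_mono subset_rfl (hle.trans hba)).trans_lt ha.2.2⟩

theorem lightest_eq_of_subset (hJK : lightest cl q J ⊆ K) (hKJ : K ⊆ J) :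
    lightest cl q K = lightest cl q J := by
  refine Subset.antisymm (fun a ha => ?_) fun a ha =>
    ⟨hJK ha, fun b hb => ha.2.1 b (hKJ hb),
      (encard_image_inter_Iio_mono hKJ le_rfl).trans_lt ha.2.2⟩
  rcases exists_mem_lightest_le_or_forall_lt (hKJ ha.1) with ⟨z, hz, hza, hle⟩ | ⟨hq, hlt⟩
  · rwa [le_antisymm (ha.2.1 z (hJK hz) hza) hle]
  · have hprefix : (lightest cl q J).encard ≤ (cl '' (K ∩ Iio a)).encard := by
      rw [← injOn_lightest.encard_image]
      exact encard_mono (image_mono fun b hb => ⟨hJK hb, hlt b hb⟩)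
    exact absurd ha.2.2 (hq.trans hprefix).not_gt

theorem lightest_lightest_union : lightest cl q (lightest cl q J ∪ N) = lightest cl q (J ∪ N) := by
  refine lightest_eq_of_subset ?_ (union_subset_union_left _ lightest_subset)
  rintro a ⟨ha | ha, hleast, hlt⟩
  · exact .inl ⟨ha, fun b hb => hleast b (.inl hb),
      (encard_image_inter_Iio_mono subset_union_left le_rfl).trans_lt hlt⟩
  · exact .inr ha

end Lightest

section UntilHit

variable {α κ : Type*} [LinearOrder α] {cl : α → κ} {q : ℕ} {J B : Set α} {R : Set κ} {a b : α}

/-- The items of `B` up to and including the first one that leads to a sampled cluster, where `R`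
is the set of sampled clusters. -/
def untilHit (cl : α → κ) (R : Set κ) (B : Set α) : Set α :=
  {a ∈ B | ∀ b ∈ B, b < a → cl b ∉ R}

open Classical in
/-- The first item of `B` that leads to a sampled cluster, if there is one. -/
noncomputable def firstHit (cl : α → κ) (R : Set κ) (B : Set α) : Option α :=
  if h : ∃ a ∈ untilHit cl R B, cl a ∈ R then some h.choose else none

theorem firstHit_eq_some_iff : firstHit cl R B = some a ↔ a ∈ untilHit cl R B ∧ cl a ∈ R := by
  have hunique : ∀ x ∈ untilHit cl R B, ∀ y ∈ untilHit cl R B, cl x ∈ R → cl y ∈ R → x = y :=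
    fun x hx y hy hxR hyR => le_antisymm (not_lt.1 fun h => hx.2 y hy.1 h hyR)
      (not_lt.1 fun h => hy.2 x hx.1 h hxR)
  unfold firstHit
  split_ifs with h
  · obtain ⟨hmem, hR⟩ := h.choose_spec
    rw [Option.some_inj]
    exact ⟨fun h => h ▸ ⟨hmem, hR⟩, fun ha => hunique _ hmem _ ha.1 hR ha.2⟩
  · exact ⟨nofun, fun ha => absurd ⟨a, ha⟩ h⟩

variable [WellFoundedLT α]

theorem exists_mem_untilHit_le (ha : a ∈ B) (haR : cl a ∈ R) :
    ∃ z ∈ untilHit cl R B, cl z ∈ R ∧ z ≤ a := by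
  obtain ⟨z, ⟨hzB, hzR⟩, hmin⟩ := wellFounded_lt.has_min {x ∈ B | cl x ∈ R} ⟨a, ha, haR⟩
  exact ⟨z, ⟨hzB, fun b hb hbz hbR => hmin b ⟨hb, hbR⟩ hbz⟩, hzR, not_lt.1 (hmin a ⟨ha, haR⟩)⟩

theorem exists_mem_untilHit_lightest
    (hhit : (q : ℕ∞) ≤ (lightest cl q J).encard → ∃ a ∈ lightest cl q J, cl a ∈ R) (hb : b ∈ J) :
    (∃ z ∈ untilHit cl R (lightest cl q J), cl z = cl b ∧ z ≤ b) ∨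
      ∃ z ∈ untilHit cl R (lightest cl q J), cl z ∈ R ∧ z < b := by
  have hfirst : ∀ a ∈ lightest cl q J, cl a ∈ R → a < b →
      ∃ z ∈ untilHit cl R (lightest cl q J), cl z ∈ R ∧ z < b := fun a ha haR hab =>
    let ⟨z, hz, hzR, hle⟩ := exists_mem_untilHit_le ha haR
    ⟨z, hz, hzR, hle.trans_lt hab⟩
  rcases exists_mem_lightest_le_or_forall_lt hb with ⟨z, hz, hzb, hle⟩ | ⟨hq, hlt⟩
  · by_cases hbefore : ∃ a ∈ lightest cl q J, a < z ∧ cl a ∈ R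
    · obtain ⟨a, ha, haz, haR⟩ := hbefore
      exact .inr (hfirst a ha haR (haz.trans_le hle))
    · push Not at hbefore
      exact .inl ⟨z, ⟨hz, hbefore⟩, hzb, hle⟩
  · obtain ⟨a, ha, haR⟩ := hhit hq
    exact .inr (hfirst a ha haR (hlt a ha))

end UntilHit

/-! ## Sampling clusters -/

section Sampling

variable {κ : Type*} {p : ℝ} {M D : Finset κ}

/-- The mean value of a function of a random subset of `M` to which every element of `M` belongs
independently with probability `p`. -/
noncomputable def bernoulliMean (p : ℝ) (M : Finset κ) : (Finset κ → ℝ) →ₗ[ℝ] ℝ :=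
  ∑ R ∈ M.powerset, (p ^ #R * (1 - p) ^ (#M - #R)) • LinearMap.proj R

theorem bernoulliMean_apply (f : Finset κ → ℝ) :
    bernoulliMean p M f = ∑ R ∈ M.powerset, p ^ #R * (1 - p) ^ (#M - #R) * f R := by
  simp [bernoulliMean]

theorem bernoulliMean_const (x : ℝ) : bernoulliMean p M (fun _ => x) = x := by
  rw [bernoulliMean_apply, ← Finset.sum_mul, Finset.sum_pow_mul_eq_add_pow]
  simp

theorem bernoulliMean_congr {f g : Finset κ → ℝ} (h : ∀ R ⊆ M, f R = g R) :
    bernoulliMean p M f = bernoulliMean p M g := by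
  simp only [bernoulliMean_apply]
  exact Finset.sum_congr rfl fun R hR => by rw [h R (Finset.mem_powerset.1 hR)]

theorem exists_lt_of_bernoulliMean_lt {f : Finset κ → ℝ} {x : ℝ} (hp0 : 0 ≤ p) (hp1 : p ≤ 1)
    (h : bernoulliMean p M f < x) : ∃ R ⊆ M, f R < x := by
  contrapose! h
  rw [← bernoulliMean_const (p := p) (M := M) x]
  simp only [bernoulliMean_apply]
  refine Finset.sum_le_sum fun R hR => mul_le_mul_of_nonneg_left (h R (Finset.mem_powerset.1 hR)) ?_
  exact mul_nonneg (pow_nonneg hp0 _) (pow_nonneg (sub_nonneg.2 hp1) _)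

theorem bernoulliMean_indicator_disjoint (hD : D ⊆ M) :
    bernoulliMean p M (indicator {R | Disjoint D R} 1) = (1 - p) ^ #D := by
  classical
  have hsdiff : {R ∈ M.powerset | Disjoint D R} = (M \ D).powerset := by
    ext R
    simp only [Finset.mem_filter, Finset.mem_powerset, Finset.subset_sdiff, disjoint_comm]
  have hcard := Finset.card_sdiff_add_card_eq_card hD
  calc bernoulliMean p M (indicator {R | Disjoint D R} 1)
      = ∑ R ∈ M.powerset with Disjoint D R, p ^ #R * (1 - p) ^ (#M - #R) := by
        simp only [bernoulliMean_apply, indicator_apply, mem_ofPred_eq, Pi.one_apply, mul_ite,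
          mul_one, mul_zero, Finset.sum_filter]
    _ = ∑ R ∈ (M \ D).powerset, (1 - p) ^ #D * (p ^ #R * (1 - p) ^ (#(M \ D) - #R)) := by
        rw [hsdiff]
        refine Finset.sum_congr rfl fun R hR => ?_
        have := Finset.card_le_card (Finset.mem_powerset.1 hR)
        rw [show #M - #R = #D + (#(M \ D) - #R) by omega, pow_add]
        ring
    _ = (1 - p) ^ #D := by
        rw [← Finset.mul_sum, Finset.sum_pow_mul_eq_add_pow]
        simp

theorem bernoulliMean_card : bernoulliMean p M (fun R => (#R : ℝ)) = #M * p := by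
  classical
  have hcard : ∀ R ⊆ M,
      (#R : ℝ) = (∑ c ∈ M, (1 - indicator {R | Disjoint {c} R} 1) : Finset κ → ℝ) R := by
    intro R hR
    rw [← Finset.inter_eq_right.2 hR, ← Finset.filter_mem_eq_inter, ← Finset.sum_boole]
    simp only [Finset.sum_apply, Pi.sub_apply, Pi.one_apply, indicator_apply, mem_ofPred_eq,
      Finset.disjoint_singleton_left]
    refine Finset.sum_congr rfl fun c hc => ?_
    by_cases hcR : c ∈ R <;> simp [hc, hcR]
  have hone : bernoulliMean p M 1 = 1 := bernoulliMean_const 1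
  rw [bernoulliMean_congr hcard, map_sum, Finset.sum_congr rfl (g := fun _ => p), Finset.sum_const,
    nsmul_eq_mul]
  intro c hc
  rw [map_sub, hone, bernoulliMean_indicator_disjoint (Finset.singleton_subset_iff.2 hc)]
  simp

section Labels

variable {α : Type*} {cl : α → κ} {B : Finset α} {V : Type*} {q : ℕ}

theorem bernoulliMean_indicator_avoid (hinj : InjOn cl B) (hB : MapsTo cl B M) :
    bernoulliMean p M (indicator {R | ∀ a ∈ B, cl a ∉ R} 1) = (1 - p) ^ #B := by
  classical
  have hdisj : {R : Finset κ | ∀ a ∈ B, cl a ∉ R} = {R | Disjoint (B.image cl) R} := by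
    ext R
    simp [Finset.disjoint_left]
  rw [hdisj, bernoulliMean_indicator_disjoint (Finset.image_subset_iff.2 hB),
    Finset.card_image_of_injOn hinj]

theorem sum_pow_card_filter_lt {M : Type*} [CommSemiring M] [LinearOrder α] (s : Finset α) (x : M) :
    ∑ a ∈ s, x ^ #{b ∈ s | b < a} = ∑ j ∈ Finset.range #s, x ^ j := by
  induction s using Finset.induction_on_max with
  | empty => simp
  | insert m s hm ih =>
    have hms : m ∉ s := fun h => lt_irrefl _ (hm m h)
    rw [Finset.sum_insert hms, Finset.card_insert_of_notMem hms, Finset.sum_range_succ, add_comm,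
      ← ih, Finset.filter_insert, if_neg (lt_irrefl m), Finset.filter_true_of_mem hm]
    congr 1
    exact Finset.sum_congr rfl fun a ha => by
      rw [Finset.filter_insert, if_neg (hm a ha).not_gt]

theorem coe_filter_eq_untilHit [LinearOrder α] [DecidableEq κ] (R : Finset κ) :
    ({a ∈ B | ∀ b ∈ B, b < a → cl b ∉ R} : Finset α) = untilHit cl (R : Set κ) (B : Set α) := by
  ext a
  simp [untilHit]

theorem bernoulliMean_ncard_untilHit_le [LinearOrder α] (hp0 : 0 < p) (hp1 : p ≤ 1)
    (hinj : InjOn cl B) (hB : MapsTo cl B M) :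
    bernoulliMean p M (fun R => ((untilHit cl (R : Set κ) (B : Set α)).ncard : ℝ)) ≤ p⁻¹ := by
  classical
  have hcount : (fun R : Finset κ => ((untilHit cl (R : Set κ) (B : Set α)).ncard : ℝ)) =
      ∑ a ∈ B, indicator {R | ∀ b ∈ {b ∈ B | b < a}, cl b ∉ R} 1 := by
    ext R
    rw [← coe_filter_eq_untilHit, ncard_coe_finset]
    simp [indicator_apply, Finset.sum_boole]
  calc bernoulliMean p M (fun R => ((untilHit cl (R : Set κ) (B : Set α)).ncard : ℝ))
      = ∑ a ∈ B, (1 - p) ^ #{b ∈ B | b < a} := by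
        rw [hcount, map_sum]
        exact Finset.sum_congr rfl fun a _ => bernoulliMean_indicator_avoid
          (hinj.mono (Finset.filter_subset _ _)) (hB.mono_left (Finset.filter_subset _ _))
    _ = ∑ j ∈ Finset.range #B, (1 - p) ^ j := sum_pow_card_filter_lt B _
    _ ≤ p⁻¹ := by
        rw [Finset.range_eq_Ico]
        simpa using geom_sum_Ico_le_of_lt_one (m := 0) (n := #B) (sub_nonneg.2 hp1)
          (sub_lt_self 1 hp0)

open Classical in
theorem bernoulliMean_card_missed_le {X : Finset V} {B : V → Finset α} (hp0 : 0 ≤ p) (hp1 : p ≤ 1)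
    (hinj : ∀ v ∈ X, InjOn cl (B v)) (hB : ∀ v ∈ X, MapsTo cl (B v) M) :
    bernoulliMean p M (fun R => (#{v ∈ X | q ≤ #(B v) ∧ ∀ a ∈ B v, cl a ∉ R} : ℝ)) ≤
      #X * (1 - p) ^ q := by
  have hcount : (fun R : Finset κ => (#{v ∈ X | q ≤ #(B v) ∧ ∀ a ∈ B v, cl a ∉ R} : ℝ)) =
      ∑ v ∈ X with q ≤ #(B v), indicator {R | ∀ a ∈ B v, cl a ∉ R} 1 := by
    ext R
    simp [indicator_apply, Finset.sum_boole, Finset.filter_filter]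
  have hlong : ∀ v ∈ ({v ∈ X | q ≤ #(B v)} : Finset V),
      bernoulliMean p M (indicator {R | ∀ a ∈ B v, cl a ∉ R} 1) ≤ (1 - p) ^ q := fun v hv => by
    obtain ⟨hvX, hqv⟩ := Finset.mem_filter.1 hv
    rw [bernoulliMean_indicator_avoid (hinj v hvX) (hB v hvX)]
    exact pow_le_pow_of_le_one (sub_nonneg.2 hp1) (sub_le_self 1 hp0) hqv
  rw [hcount, map_sum, ← nsmul_eq_mul]
  exact (Finset.sum_le_card_nsmul _ _ _ hlong).trans
    (nsmul_le_nsmul_left (pow_nonneg (sub_nonneg.2 hp1) q) (Finset.card_filter_le _ _))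

variable [LinearOrder α] {X : Finset V} {B : V → Finset α} {n s : ℕ}

open Classical in
/-- The potential of a sample `R` of the clusters `M`, for the lists `B v` with `v ∈ X`. Its terms
measure the number of sampled clusters, the number of items up to the first hit and the number of
lists of length at least `q` without a hit; each is scaled to have mean at most `1 / 3` at sampling
rate `1 / (3 * s)`. -/
noncomputable def sampleCost (n s q : ℕ) (cl : α → κ) (X : Finset V) (B : V → Finset α)
    (M : Finset κ) : Finset κ → ℝ :=
  (s / #M : ℝ) • (fun R : Finset κ => (#R : ℝ)) +
    (9 * n * s : ℝ)⁻¹ •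
      (∑ v ∈ X, fun R : Finset κ => ((untilHit cl (R : Set κ) (B v : Set α)).ncard : ℝ)) +
    fun R : Finset κ => (#{v ∈ X | q ≤ #(B v) ∧ ∀ a ∈ B v, cl a ∉ R} : ℝ)

theorem bernoulliMean_sampleCost_lt_one (hX : #X ≤ n) (hn : 0 < n) (hs : 0 < s)
    (hq : n * (1 - 1 / (3 * s) : ℝ) ^ q < 1 / 3)
    (hinj : ∀ v ∈ X, InjOn cl (B v)) (hB : ∀ v ∈ X, MapsTo cl (B v) M) :
    bernoulliMean (1 / (3 * s)) M (sampleCost n s q cl X B M) < 1 := by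
  have hs1 : (1 : ℝ) ≤ s := by exact_mod_cast hs
  have hp0 : (0 : ℝ) < 1 / (3 * s) := by positivity
  have hp1 : (1 / (3 * s) : ℝ) ≤ 1 := (div_le_one (by positivity)).2 (by linarith)
  have hsize : (s / #M : ℝ) * (#M * (1 / (3 * s))) ≤ 1 / 3 := by
    rcases eq_or_ne (#M : ℝ) 0 with h | h
    · simp [h]
    · exact (by field_simp : (s / #M : ℝ) * (#M * (1 / (3 * s))) = 1 / 3).le
  have hadded : (9 * n * s : ℝ)⁻¹ * bernoulliMean (1 / (3 * s)) M
      (∑ v ∈ X, fun R : Finset κ => ((untilHit cl (R : Set κ) (B v : Set α)).ncard : ℝ)) ≤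
      1 / 3 := by
    calc _ ≤ (9 * n * s : ℝ)⁻¹ * (#X • (1 / (3 * s) : ℝ)⁻¹) := by
          gcongr
          rw [map_sum]
          exact Finset.sum_le_card_nsmul _ _ _ fun v hv =>
            bernoulliMean_ncard_untilHit_le hp0 hp1 (hinj v hv) (hB v hv)
      _ ≤ (9 * n * s : ℝ)⁻¹ * (n * (1 / (3 * s) : ℝ)⁻¹) := by
          rw [nsmul_eq_mul]
          gcongr
      _ = 1 / 3 := by
          field_simp
          norm_num
  have hmissed := (bernoulliMean_card_missed_le (q := q) hp0.le hp1 hinj hB).trans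
    (mul_le_mul_of_nonneg_right (Nat.cast_le.2 hX) (pow_nonneg (sub_nonneg.2 hp1) q))
  rw [sampleCost, map_add, map_add, map_smul, map_smul, bernoulliMean_card, smul_eq_mul,
    smul_eq_mul]
  linarith

theorem exists_sample (hX : #X ≤ n) (hn : 0 < n) (hs : 0 < s)
    (hq : n * (1 - 1 / (3 * s) : ℝ) ^ q < 1 / 3)
    (hinj : ∀ v ∈ X, InjOn cl (B v)) (hB : ∀ v ∈ X, MapsTo cl (B v) M) :
    ∃ R ⊆ M, #R * s ≤ #M ∧ (∀ v ∈ X, q ≤ #(B v) → ∃ a ∈ B v, cl a ∈ R) ∧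
      ∑ v ∈ X, (untilHit cl (R : Set κ) (B v : Set α)).ncard ≤ 9 * n * s := by
  classical
  have hp1 : (1 / (3 * s) : ℝ) ≤ 1 := by
    rw [div_le_one (by positivity)]
    exact_mod_cast (by omega : 1 ≤ 3 * s)
  obtain ⟨R, hRM, hR⟩ := exists_lt_of_bernoulliMean_lt (by positivity) hp1
    (bernoulliMean_sampleCost_lt_one hX hn hs hq hinj hB)
  set size : ℝ := s / #M * #R with hsize
  set added : ℝ := (9 * n * s : ℝ)⁻¹ * ∑ v ∈ X, ((untilHit cl (R : Set κ) (B v : Set α)).ncard : ℝ)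
    with hadded
  set missed : Finset V := {v ∈ X | q ≤ #(B v) ∧ ∀ a ∈ B v, cl a ∉ R}
  have hcost : size + added + #missed < 1 := by
    simpa only [sampleCost, Pi.add_apply, Pi.smul_apply, smul_eq_mul, Finset.sum_apply] using hR
  have hsize0 : 0 ≤ size := by positivity
  have hadded0 : 0 ≤ added := by positivity
  have : (0 : ℝ) ≤ #missed := by positivity
  refine ⟨R, hRM, ?_, fun v hv hqv => ?_, ?_⟩
  · rcases M.eq_empty_or_nonempty with rfl | hM
    · simp [Finset.subset_empty.1 hRM]
    · have : size ≤ 1 := by linarith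
      rw [hsize, div_mul_eq_mul_div, div_le_one (by exact_mod_cast hM.card_pos), mul_comm] at this
      exact_mod_cast this
  · have hempty : missed = ∅ := by
      rw [← Finset.card_eq_zero, ← Nat.lt_one_iff]
      exact_mod_cast (by linarith : (#missed : ℝ) < 1)
    by_contra! hcon
    exact Finset.notMem_empty v (hempty ▸ Finset.mem_filter.2 ⟨hv, hqv, hcon⟩)
  · have : added ≤ 1 := by linarith
    rw [hadded, inv_mul_le_iff₀ (by positivity), mul_one] at this
    exact_mod_cast this

end Labels

end Sampling

/-! ## One phase of the clustering -/

section Phase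

variable {V : Type*}

/-- An edge at a node, as the pair of its weight and its other endpoint. Items are compared by
weight first. -/
abbrev Item (V : Type*) : Type _ := ℕ ×ₗ V

/-- The weight of an incident edge. -/
def Item.weight (a : Item V) : ℕ := (ofLex a).1

/-- The other endpoint of an incident edge. -/
def Item.endpoint (a : Item V) : V := (ofLex a).2

/-- The weighted edge that appears at the node `v` as the item `a`. -/
def Item.edgeAt (v : V) (a : Item V) : Sym2 V × ℕ := (s(v, a.endpoint), a.weight)

theorem Item.weight_mono [Preorder V] {a b : Item V} (h : a ≤ b) : a.weight ≤ b.weight :=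
  Prod.Lex.monotone_fst_ofLex h

/-- A clustering of some of the nodes. A clustered node is joined to the center of its cluster by a
path none of whose edges is heavier than `radius`; a node with radius `⊤` is unclustered, and its
center is meaningless. -/
structure Clustering (V : Type*) where
  center : V → V
  radius : V → ℕ∞

/-- The center of the cluster to which an incident edge leads. -/
def Clustering.itemCenter (f : Clustering V) (a : Item V) : V := f.center a.endpoint

/-- The items of `v` among `I` that join clustered nodes and are at least as heavy as their
radii. -/
def live (f : Clustering V) (v : V) (I : Set (Item V)) : Set (Item V) :=
  {a ∈ I | f.radius v ≤ a.weight ∧ f.radius a.endpoint ≤ a.weight}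

/-- The edges of `E` at `v`. -/
def incidentItems (E : Set (Sym2 V × ℕ)) (v : V) : Set (Item V) :=
  {a | a.edgeAt v ∈ E}

/-- The clusters that occur in the lists `B`. -/
def centers (f : Clustering V) (B : V → Set (Item V)) : Set V :=
  ⋃ v, f.itemCenter '' B v

variable [LinearOrder V]

/-- The lightest live edges from `v` to each of the `q` nearest clusters. -/
def candidates (f : Clustering V) (q : ℕ) (v : V) (I : Set (Item V)) : Set (Item V) :=
  lightest f.itemCenter q (live f v I)

/-- The lists of candidates of all nodes of the graph with edge set `E`. -/
def candidateLists (f : Clustering V) (q : ℕ) (E : Set (Sym2 V × ℕ)) (v : V) : Set (Item V) :=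
  candidates f q v (incidentItems E v)

/-- The edges that all nodes add to the spanner when the clusters `R` are sampled. -/
def addedEdges (f : Clustering V) (R : Set V) (B : V → Set (Item V)) : Set (Sym2 V × ℕ) :=
  ⋃ v, Item.edgeAt v '' untilHit f.itemCenter R (B v)

/-- The clustering in which every node joins the nearest sampled cluster in its list, if there is
one. -/
noncomputable def joinSampled (f : Clustering V) (R : Set V) (B : V → Set (Item V)) :
    Clustering V where
  center v := (firstHit f.itemCenter R (B v)).elim v f.itemCenter
  radius v := (firstHit f.itemCenter R (B v)).elim ⊤ fun a => (a.weight : ℕ∞)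

/-- A set `R` of sampled clusters is good if it contains at most one in `s` clusters, meets all
lists of length at least `q` and causes few edges to be added to the spanner. -/
structure GoodSample (n s q : ℕ) (f : Clustering V) (B : V → Set (Item V)) (R : Set V) :
    Prop where
  subset : R ⊆ centers f B
  encard_mul_le : R.encard * s ≤ (centers f B).encard
  hit : ∀ v, (q : ℕ∞) ≤ (B v).encard → ∃ a ∈ B v, f.itemCenter a ∈ R
  encard_addedEdges_le : (addedEdges f R B).encard ≤ (9 * n * s : ℕ)

open Classical in
/-- A good sample, chosen as a function of the data known to all nodes. -/
noncomputable def sample (n s q : ℕ) (f : Clustering V) (B : V → Set (Item V)) : Set V :=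
  if h : ∃ R, GoodSample n s q f B R then h.choose else ∅

/-- The current clustering and the edges added to the spanner so far. -/
structure Progress (V : Type*) where
  clustering : Clustering V
  spanner : Set (Sym2 V × ℕ)

/-- Progress before the first phase: all nodes are clusters of their own. -/
def Progress.start : Progress V := ⟨⟨id, 0⟩, ∅⟩

/-- One phase of the algorithm, in which all nodes make the same choice of a sample from the
lists of all nodes. -/
noncomputable def phase (n s q : ℕ) (P : Progress V) (B : V → Set (Item V)) : Progress V where
  clustering := joinSampled P.clustering (sample n s q P.clustering B) B
  spanner := P.spanner ∪ addedEdges P.clustering (sample n s q P.clustering B) B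

/-- Progress after `t` phases. -/
noncomputable def phases (E : Set (Sym2 V × ℕ)) (n s q : ℕ) : ℕ → Progress V
  | 0 => .start
  | t + 1 => phase n s q (phases E n s q t) (candidateLists (phases E n s q t).clustering q E)

variable {f : Clustering V} {B : V → Set (Item V)} {R : Set V} {X : Finset V} {n s q : ℕ} {v : V}
  {E : Set (Sym2 V × ℕ)}

theorem goodSample_sample (h : ∃ R, GoodSample n s q f B R) :
    GoodSample n s q f B (sample n s q f B) := by
  rw [sample, dif_pos h]
  exact h.choose_spec

theorem joinSampled_eq_of_radius_ne_top (h : (joinSampled f R B).radius v ≠ ⊤) :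
    ∃ a ∈ untilHit f.itemCenter R (B v), f.itemCenter a ∈ R ∧
      (joinSampled f R B).center v = f.itemCenter a ∧ (joinSampled f R B).radius v = a.weight := by
  cases hfirst : firstHit f.itemCenter R (B v) with
  | none => simp [joinSampled, hfirst] at h
  | some a =>
    obtain ⟨ha, haR⟩ := firstHit_eq_some_iff.1 hfirst
    exact ⟨a, ha, haR, by simp [joinSampled, hfirst], by simp [joinSampled, hfirst]⟩

theorem radius_joinSampled_eq {a : Item V} (ha : a ∈ untilHit f.itemCenter R (B v))
    (haR : f.itemCenter a ∈ R) : (joinSampled f R B).radius v = a.weight := by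
  simp [joinSampled, firstHit_eq_some_iff.2 ⟨ha, haR⟩]

theorem candidates_subset_live {I : Set (Item V)} : candidates f q v I ⊆ live f v I :=
  lightest_subset

theorem mem_of_mem_candidateLists {a : Item V} (ha : a ∈ candidateLists f q E v) :
    a.edgeAt v ∈ E :=
  (candidates_subset_live ha).1

theorem encard_addedEdges_le (hX : ∀ v ∉ X, B v = ∅) :
    (addedEdges f R B).encard ≤ ∑ v ∈ X, (untilHit f.itemCenter R (B v)).encard := by
  have hsub : addedEdges f R B ⊆ ⋃ v ∈ X, Item.edgeAt v '' untilHit f.itemCenter R (B v) := by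
    refine iUnion_subset fun v => ?_
    by_cases hv : v ∈ X
    · exact subset_biUnion_of_mem (u := fun v => Item.edgeAt v '' untilHit f.itemCenter R (B v)) hv
    · simp [hX v hv, untilHit]
  exact (encard_mono hsub).trans ((X.set_encard_biUnion_le _).trans
    (Finset.sum_le_sum fun v _ => encard_image_le _ _))

theorem exists_goodSample (hXn : #X ≤ n) (hn : 0 < n) (hs : 0 < s)
    (hq : n * (1 - 1 / (3 * s) : ℝ) ^ q < 1 / 3) (hX : ∀ v ∉ X, B v = ∅)
    (hB : ∀ v, (B v).Finite) (hinj : ∀ v, InjOn f.itemCenter (B v)) :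
    ∃ R, GoodSample n s q f B R := by
  classical
  lift B to V → Finset (Item V) using hB
  have hq0 : q ≠ 0 := by
    rintro rfl
    have : (1 : ℝ) ≤ n := by exact_mod_cast hn
    linarith
  have hcenters : centers f (fun v => (B v : Set (Item V))) =
      (X.biUnion fun v => (B v).image f.itemCenter : Finset V) := by
    ext c
    simp only [centers, mem_iUnion, Finset.coe_biUnion, Finset.coe_image, Finset.mem_coe,
      exists_prop]
    refine exists_congr fun v => (and_iff_right_of_imp ?_).symm
    rintro ⟨a, ha, -⟩
    exact by_contra fun hv => notMem_empty a (hX v hv ▸ ha)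
  obtain ⟨R, hRM, hRs, hhit, hadded⟩ := exists_sample hXn hn hs hq (fun v _ => hinj v)
    (M := X.biUnion fun v => (B v).image f.itemCenter) fun v hv a ha =>
      Finset.mem_coe.2 (Finset.mem_biUnion.2 ⟨v, hv, Finset.mem_image_of_mem _ ha⟩)
  refine ⟨R, hcenters ▸ Finset.coe_subset.2 hRM, ?_, fun v hv => ?_, ?_⟩
  · rw [hcenters, encard_coe_eq_coe_finsetCard, encard_coe_eq_coe_finsetCard]
    exact_mod_cast hRs
  · rw [encard_coe_eq_coe_finsetCard, Nat.cast_le] at hv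
    refine hhit v (by_contra fun hvX => hq0 ?_) hv
    rw [Finset.coe_eq_empty.1 (hX v hvX)] at hv
    simpa using hv
  · refine (encard_addedEdges_le hX).trans ?_
    have hfin : ∀ v, (untilHit f.itemCenter R (B v : Set (Item V))).Finite := fun v =>
      (B v).finite_toSet.subset fun _ h => h.1
    simp_rw [← (hfin _).cast_ncard_eq]
    exact_mod_cast hadded

theorem exists_goodSample_candidateLists (hXn : #X ≤ n) (hn : 0 < n) (hs : 0 < s)
    (hq : n * (1 - 1 / (3 * s) : ℝ) ^ q < 1 / 3) (hEX : ∀ e ∈ E, ∀ v ∈ e.1, v ∈ X) :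
    ∃ R, GoodSample n s q f (candidateLists f q E) R := by
  refine exists_goodSample hXn hn hs hq (fun v hv => ?_)
    (fun v => finite_of_encard_le_coe encard_lightest_le) fun v => injOn_lightest
  exact eq_empty_of_forall_notMem fun a ha =>
    hv (hEX _ (mem_of_mem_candidateLists ha) v (Sym2.mem_mk_left _ _))

end Phase

/-! ## Stretch and size -/

section Reach

variable {V : Type*}

/-- There is a walk from `x` to `y` of at most `l` edges of `S`, each of weight at most `r`. -/
inductive Reach (S : Set (Sym2 V × ℕ)) (r : ℕ) : ℕ → V → V → Prop
  | refl (l : ℕ) (x : V) : Reach S r l x x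
  | cons {l : ℕ} {x y z : V} {w : ℕ} (h : (s(x, y), w) ∈ S) (hw : w ≤ r) (h' : Reach S r l y z) :
      Reach S r (l + 1) x z

variable {S S' : Set (Sym2 V × ℕ)} {r l l' : ℕ} {x y z : V}

theorem Reach.mono (h : Reach S r l x y) (hS : S ⊆ S') (hl : l ≤ l') : Reach S' r l' x y := by
  induction h generalizing l' with
  | refl => exact .refl _ _
  | cons h hw _ ih =>
    obtain ⟨m, rfl⟩ := Nat.exists_eq_succ_of_ne_zero (by omega : l' ≠ 0)
    exact .cons (hS h) hw (ih (by omega))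

theorem Reach.trans (h : Reach S r l x y) (h' : Reach S r l' y z) : Reach S r (l + l') x z := by
  induction h with
  | refl => exact h'.mono subset_rfl (Nat.le_add_left _ _)
  | cons h hw _ ih =>
    rw [Nat.add_right_comm]
    exact .cons h hw (ih h')

theorem Reach.symm (h : Reach S r l x y) : Reach S r l y x := by
  induction h with
  | refl => exact .refl _ _
  | cons h hw _ ih => exact ih.trans (.cons (Sym2.eq_swap ▸ h) hw (.refl 0 _))

end Reach

section Correctness

variable {V : Type*} {E : Set (Sym2 V × ℕ)} {P : Progress V} {R : Set V} {X : Finset V}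
  {n s q k l t : ℕ} {u v : V} {w : ℕ}

/-- After `t` phases, clustered nodes reach their centers by `t` edges no heavier than their radii,
and every edge is spanned by `l` edges that are no heavier, or is live. -/
structure PhaseInvariant (E : Set (Sym2 V × ℕ)) (l t : ℕ) (P : Progress V) : Prop where
  subset : P.spanner ⊆ E
  reach : ∀ v, ∀ w : ℕ, P.clustering.radius v ≤ w →
    Reach P.spanner w t v (P.clustering.center v)
  covered : ∀ u v w, (s(u, v), w) ∈ E →
    Reach P.spanner w l u v ∨ P.clustering.radius u ≤ w ∧ P.clustering.radius v ≤ w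

theorem phaseInvariant_start : PhaseInvariant E l 0 (.start : Progress V) where
  subset := empty_subset _
  reach v _ _ := .refl 0 v
  covered _ _ _ _ := .inr ⟨zero_le, zero_le⟩

variable [LinearOrder V]

theorem edgeAt_mem_addedEdges {f : Clustering V} {B : V → Set (Item V)} {a : Item V}
    (ha : a ∈ untilHit f.itemCenter R (B v)) : a.edgeAt v ∈ addedEdges f R B :=
  mem_iUnion.2 ⟨v, a, ha, rfl⟩

theorem addedEdges_subset {f : Clustering V} :
    addedEdges f R (candidateLists f q E) ⊆ E := by
  refine iUnion_subset fun v => ?_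
  rintro _ ⟨a, ha, rfl⟩
  exact mem_of_mem_candidateLists ha.1

theorem PhaseInvariant.reach_center_joinSampled (hP : PhaseInvariant E l t P)
    (hw : (joinSampled P.clustering R (candidateLists P.clustering q E)).radius v ≤ w) :
    Reach (P.spanner ∪ addedEdges P.clustering R (candidateLists P.clustering q E)) w (t + 1) v
      ((joinSampled P.clustering R (candidateLists P.clustering q E)).center v) := by
  obtain ⟨a, ha, -, hcenter, hradius⟩ :=
    joinSampled_eq_of_radius_ne_top (hw.trans_lt (ENat.natCast_lt_top w)).ne
  have haw : a.weight ≤ w := by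
    rwa [hradius, Nat.cast_le] at hw
  have hlive : P.clustering.radius a.endpoint ≤ w :=
    (candidates_subset_live ha.1).2.2.trans (Nat.cast_le.2 haw)
  rw [hcenter]
  exact .cons (.inr (edgeAt_mem_addedEdges ha)) haw
    ((hP.reach _ _ hlive).mono subset_union_left le_rfl)

theorem PhaseInvariant.reach_of_radius_joinSampled_gt [WellFoundedLT V]
    (hP : PhaseInvariant E l t P) (hl : 2 * t + 1 ≤ l)
    (hR : GoodSample n s q P.clustering (candidateLists P.clustering q E) R)
    (h : (s(u, v), w) ∈ E) (hu : P.clustering.radius u ≤ w) (hv : P.clustering.radius v ≤ w)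
    (hgt : w < (joinSampled P.clustering R (candidateLists P.clustering q E)).radius u) :
    Reach (P.spanner ∪ addedEdges P.clustering R (candidateLists P.clustering q E)) w l u v := by
  let b : Item V := toLex (w, v)
  have hb : b ∈ live P.clustering u (incidentItems E u) := ⟨h, hu, hv⟩
  rcases exists_mem_untilHit_lightest (hR.hit u) hb with ⟨z, hz, hcenter, hzb⟩ | ⟨z, hz, hzR, hzb⟩
  · have hzw : z.weight ≤ w := Item.weight_mono hzb
    have hendpoint : P.clustering.radius z.endpoint ≤ w :=
      (candidates_subset_live hz.1).2.2.trans (Nat.cast_le.2 hzw)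
    have hz_to_center := (hP.reach _ _ hendpoint).mono (l' := t)
      (subset_union_left (t := addedEdges P.clustering R (candidateLists P.clustering q E))) le_rfl
    have hcenter_to_v := ((hP.reach _ _ hv).mono (l' := t)
      (subset_union_left (t := addedEdges P.clustering R (candidateLists P.clustering q E)))
      le_rfl).symm
    rw [show P.clustering.center z.endpoint = P.clustering.center v from hcenter] at hz_to_center
    exact (Reach.cons (.inr (edgeAt_mem_addedEdges hz)) hzw
      (hz_to_center.trans hcenter_to_v)).mono subset_rfl (by omega)
  · rw [radius_joinSampled_eq hz hzR, Nat.cast_lt] at hgt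
    exact absurd (Item.weight_mono hzb.le) hgt.not_ge

theorem PhaseInvariant.phase [WellFoundedLT V] (hP : PhaseInvariant E l t P)
    (hl : 2 * t + 1 ≤ l)
    (hR : ∃ R, GoodSample n s q P.clustering (candidateLists P.clustering q E) R) :
    PhaseInvariant E l (t + 1) (phase n s q P (candidateLists P.clustering q E)) where
  subset := union_subset hP.subset addedEdges_subset
  reach _ _ hw := hP.reach_center_joinSampled hw
  covered u v w h := by
    have hgood := goodSample_sample hR
    rcases hP.covered u v w h with hreach | ⟨hu, hv⟩
    · exact .inl (hreach.mono subset_union_left le_rfl)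
    refine or_iff_not_imp_right.2 fun hnot => ?_
    rcases not_and_or.1 hnot with hgt | hgt
    · exact hP.reach_of_radius_joinSampled_gt hl hgood h hu hv (not_le.1 hgt)
    · exact (hP.reach_of_radius_joinSampled_gt hl hgood (Sym2.eq_swap ▸ h) hv hu
        (not_le.1 hgt)).symm

theorem phaseInvariant_phases [WellFoundedLT V]
    (hR : ∀ f, ∃ R, GoodSample n s q f (candidateLists f q E) R) :
    ∀ t ≤ k, PhaseInvariant E (2 * k - 1) t (phases E n s q t)
  | 0, _ => phaseInvariant_start
  | t + 1, ht => (phaseInvariant_phases hR t (by omega)).phase (by omega) (hR _)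

/-- The clusters that occur in some list after `t` phases. -/
def phaseCenters (E : Set (Sym2 V × ℕ)) (n s q t : ℕ) : Set V :=
  centers (phases E n s q t).clustering (candidateLists (phases E n s q t).clustering q E)

/-- The clusters sampled after `t` phases. -/
def phaseSample (E : Set (Sym2 V × ℕ)) (n s q t : ℕ) : Set V :=
  sample n s q (phases E n s q t).clustering (candidateLists (phases E n s q t).clustering q E)

theorem phaseCenters_zero_subset (hEX : ∀ e ∈ E, ∀ v ∈ e.1, v ∈ X) :
    phaseCenters E n s q 0 ⊆ X := by
  refine iUnion_subset fun v => ?_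
  rintro _ ⟨a, ha, rfl⟩
  exact hEX _ (mem_of_mem_candidateLists ha) _ (Sym2.mem_mk_right _ _)

theorem phaseCenters_succ_subset : phaseCenters E n s q (t + 1) ⊆ phaseSample E n s q t := by
  refine iUnion_subset fun v => ?_
  rintro _ ⟨a, ha, rfl⟩
  have hlive := (candidates_subset_live ha).2.2
  obtain ⟨b, -, hbR, hcenter, -⟩ :=
    joinSampled_eq_of_radius_ne_top (hlive.trans_lt (ENat.natCast_lt_top _)).ne
  exact (congrArg (· ∈ phaseSample E n s q t) hcenter).mpr hbR

theorem encard_phaseSample_mul_pow_le (hXn : #X ≤ n) (hEX : ∀ e ∈ E, ∀ v ∈ e.1, v ∈ X)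
    (hR : ∀ f, ∃ R, GoodSample n s q f (candidateLists f q E) R) (t : ℕ) :
    (phaseSample E n s q t).encard * s ^ (t + 1) ≤ n := by
  have hsample : ∀ t, (phaseSample E n s q t).encard * s ≤ (phaseCenters E n s q t).encard :=
    fun t => (goodSample_sample (hR _)).encard_mul_le
  induction t with
  | zero =>
    rw [zero_add, pow_one]
    refine ((hsample 0).trans (encard_mono (phaseCenters_zero_subset hEX))).trans ?_
    rw [encard_coe_eq_coe_finsetCard]
    exact_mod_cast hXn
  | succ t ih =>
    calc (phaseSample E n s q (t + 1)).encard * s ^ (t + 1 + 1)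
        = (phaseSample E n s q (t + 1)).encard * s * s ^ (t + 1) := by ring
      _ ≤ (phaseCenters E n s q (t + 1)).encard * s ^ (t + 1) := by gcongr; exact hsample _
      _ ≤ (phaseSample E n s q t).encard * s ^ (t + 1) := by
        gcongr
        exact phaseCenters_succ_subset
      _ ≤ n := ih

theorem radius_phases_succ_eq_top (hXn : #X ≤ n) (hEX : ∀ e ∈ E, ∀ v ∈ e.1, v ∈ X)
    (hR : ∀ f, ∃ R, GoodSample n s q f (candidateLists f q E) R) (hns : n < s ^ (t + 1)) (v : V) :
    (phases E n s q (t + 1)).clustering.radius v = ⊤ := by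
  have hempty : phaseSample E n s q t = ∅ := by
    by_contra hne
    have hcard : (1 : ℕ∞) ≤ (phaseSample E n s q t).encard :=
      one_le_encard_iff_nonempty.2 (nonempty_iff_ne_empty.2 hne)
    have hle : (s : ℕ∞) ^ (t + 1) ≤ n :=
      (le_mul_of_one_le_left' hcard).trans (encard_phaseSample_mul_pow_le hXn hEX hR t)
    exact hns.not_ge (by exact_mod_cast hle)
  by_contra htop
  obtain ⟨a, -, haR, -⟩ := joinSampled_eq_of_radius_ne_top htop
  exact notMem_empty _ (hempty.subset haR)

theorem reach_phases [WellFoundedLT V] (hXn : #X ≤ n) (hEX : ∀ e ∈ E, ∀ v ∈ e.1, v ∈ X)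
    (hR : ∀ f, ∃ R, GoodSample n s q f (candidateLists f q E) R) (hk : k ≠ 0) (hns : n < s ^ k)
    (h : (s(u, v), w) ∈ E) : Reach (phases E n s q k).spanner w (2 * k - 1) u v := by
  refine ((phaseInvariant_phases hR k le_rfl).covered u v w h).resolve_right ?_
  rintro ⟨hu, -⟩
  obtain ⟨t, rfl⟩ := Nat.exists_eq_succ_of_ne_zero hk
  exact (ENat.natCast_lt_top w).not_ge (radius_phases_succ_eq_top hXn hEX hR hns u ▸ hu)

theorem encard_spanner_phases_le (hR : ∀ f, ∃ R, GoodSample n s q f (candidateLists f q E) R)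
    (t : ℕ) : (phases E n s q t).spanner.encard ≤ (t * (9 * n * s) : ℕ) := by
  induction t with
  | zero => simp [phases, Progress.start]
  | succ t ih =>
    refine (encard_union_le _ _).trans ?_
    rw [Nat.succ_mul, Nat.cast_add]
    exact add_le_add ih (goodSample_sample (hR _)).encard_addedEdges_le

theorem radius_phases_le {W : ℕ} (hW : ∀ e ∈ E, e.2 ≤ W) (t : ℕ) (v : V)
    (hv : (phases E n s q t).clustering.radius v ≠ ⊤) :
    (phases E n s q t).clustering.radius v ≤ W := by
  cases t with
  | zero => exact zero_le
  | succ t =>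
    obtain ⟨a, ha, -, -, hradius⟩ := joinSampled_eq_of_radius_ne_top hv
    exact hradius.trans_le (Nat.cast_le.2 (hW _ (mem_of_mem_candidateLists ha.1)))

end Correctness

section Spanner

variable {V : Type} {W : Type*} {G H : SimpleGraph V} {w : Sym2 V → ℕ} {f : V → W}
  {l r : ℕ} {u v : V}

/-- The weighted edges of `(G, w)` after the nodes have been renamed by `f`: `identEdges` for an
arbitrary type of names, and `weightedEdges` if `f` is the identity. -/
def renamedEdges (G : SimpleGraph V) (w : Sym2 V → ℕ) (f : V → W) : Set (Sym2 W × ℕ) :=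
  (fun e => (e.map f, w e)) '' G.edgeSet

theorem identEdges_eq_renamedEdges {n : ℕ} (G : SimpleGraph (Fin n)) (w : Sym2 (Fin n) → ℕ)
    (ident : Fin n → ℕ) : identEdges G w ident = renamedEdges G w ident := by
  simp only [identEdges, renamedEdges, image, eq_comm]

theorem weightedEdges_eq_renamedEdges {n : ℕ} (G : SimpleGraph (Fin n)) (w : Sym2 (Fin n) → ℕ) :
    weightedEdges G w = renamedEdges G w id := by
  simp only [weightedEdges, renamedEdges, image, eq_comm, Sym2.map_id', id_eq]

theorem mem_range_of_mem_renamedEdges {e : Sym2 W × ℕ} (he : e ∈ renamedEdges G w f) {y : W}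
    (hy : y ∈ e.1) : y ∈ range f := by
  obtain ⟨e, -, rfl⟩ := he
  obtain ⟨u, -, hu⟩ := Sym2.mem_map.1 hy
  exact ⟨u, hu⟩

theorem mem_renamedEdges (hf : f.Injective) {y : W} :
    (s(f u, y), r) ∈ renamedEdges G w f ↔ ∃ v, G.Adj u v ∧ y = f v ∧ r = w s(u, v) := by
  constructor
  · rintro ⟨e, he, heq⟩
    induction e with | _ a b
    simp only [Sym2.map_mk, Prod.mk.injEq, Sym2.eq_iff] at heq
    obtain ⟨⟨hu, rfl⟩ | ⟨rfl, hu⟩, rfl⟩ := heq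
    · obtain rfl := hf hu
      exact ⟨b, he, rfl, rfl⟩
    · obtain rfl := hf hu
      exact ⟨a, he.symm, rfl, by rw [Sym2.eq_swap]⟩
  · rintro ⟨v, h, rfl, rfl⟩
    exact ⟨s(u, v), h, rfl⟩

theorem wdist_triangle (H : SimpleGraph V) (w : Sym2 V → ℕ) (x y z : V) :
    wdist H w x z ≤ wdist H w x y + wdist H w y z := by
  refine ENat.le_iInf_add_iInf fun p p' => iInf_le_of_le (p.append p') ?_
  rw [SimpleGraph.Walk.edges_append, List.map_append, List.sum_append, Nat.cast_add]

@[simp]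
theorem wdist_self (H : SimpleGraph V) (w : Sym2 V → ℕ) (x : V) : wdist H w x x = 0 :=
  nonpos_iff_eq_zero.1 (iInf_le_of_le .nil (by simp))

theorem wdist_le_of_adj (w : Sym2 V → ℕ) (h : H.Adj u v) : wdist H w u v ≤ w s(u, v) :=
  iInf_le_of_le (.cons h .nil) (by simp)

theorem Reach.wdist_le (hf : f.Injective) {x y : W} (h : Reach (renamedEdges H w f) r l x y)
    (hx : x = f u) (hy : y = f v) : wdist H w u v ≤ (l * r : ℕ) := by
  induction h generalizing u with
  | refl =>
    obtain rfl := hf (hx.symm.trans hy)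
    simp
  | @cons l x y z w' h hw _ ih =>
    subst hx
    obtain ⟨m, hm, rfl, rfl⟩ := (mem_renamedEdges hf).1 h
    calc wdist H w u v ≤ wdist H w u m + wdist H w m v := wdist_triangle ..
      _ ≤ (r : ℕ) + (l * r : ℕ) :=
        add_le_add ((wdist_le_of_adj w hm).trans (Nat.cast_le.2 hw)) (ih rfl hy)
      _ = ((l + 1) * r : ℕ) := by push_cast; ring

theorem isSpanner_of_wdist_le_of_adj (hl : l ≠ 0) (hH : H ≤ G)
    (h : ∀ u v, G.Adj u v → wdist H w u v ≤ (l * w s(u, v) : ℕ)) : IsSpanner l G w H := by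
  refine ⟨hH, fun u v => ?_⟩
  have hwalk (p : G.Walk u v) : wdist H w u v ≤ (l : ℕ∞) * (p.edges.map w).sum := by
    induction p with
    | nil => simp
    | cons hadj p ih =>
      refine (wdist_triangle H w _ _ _).trans ((add_le_add (h _ _ hadj) ih).trans_eq ?_)
      rw [SimpleGraph.Walk.edges_cons, List.map_cons, List.sum_cons]
      push_cast
      ring
  rw [wdist.eq_1 G, ENat.mul_iInf_of_ne (by exact_mod_cast hl)]
  exact le_iInf hwalk

theorem exists_isSpanner (hf : f.Injective) (hl : l ≠ 0) {S : Set (Sym2 W × ℕ)}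
    (hS : S ⊆ renamedEdges G w f)
    (hreach : ∀ x y r, (s(x, y), r) ∈ renamedEdges G w f → Reach S r l x y) :
    ∃ H : SimpleGraph V, IsSpanner l G w H ∧ H.edgeSet.encard = S.encard ∧
      S = renamedEdges H w f := by
  obtain ⟨T, hTG, rfl⟩ := subset_image_iff.1 hS
  have hT : (SimpleGraph.fromEdgeSet T).edgeSet = T := by
    rw [SimpleGraph.edgeSet_fromEdgeSet, sdiff_eq_left, disjoint_left]
    exact fun e he => G.not_isDiag_of_mem_edgeSet (hTG he)
  have hedges : renamedEdges (SimpleGraph.fromEdgeSet T) w f = (fun e => (e.map f, w e)) '' T := by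
    rw [renamedEdges, hT]
  refine ⟨.fromEdgeSet T, isSpanner_of_wdist_le_of_adj hl ?_ fun u v h => ?_, ?_, hedges.symm⟩
  · rwa [← SimpleGraph.edgeSet_subset_edgeSet, hT]
  · exact (hedges ▸ hreach _ _ _ ((mem_renamedEdges hf).2 ⟨v, h, rfl, rfl⟩)).wdist_le hf rfl rfl
  · rw [hT, Function.Injective.encard_image]
    exact fun e e' h => Sym2.map.injective hf (Prod.ext_iff.1 h).1

theorem isSpanner_bot_of_subsingleton [Subsingleton V] (l : ℕ) (G : SimpleGraph V)
    (w : Sym2 V → ℕ) : IsSpanner l G w ⊥ := by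
  refine ⟨bot_le, fun u v => ?_⟩
  obtain rfl := Subsingleton.elim u v
  simp

end Spanner

/-! ## Encodings -/

section Encoding

variable {α κ : Type*} {β n c d M j : ℕ} {A C : Set α} {a : α}

/-- Words of `β` bits, read by `dec`, can express every element of `A` as well as `none`. -/
def IsDecoder (dec : (Fin β → Bool) → Option α) (A : Set α) : Prop :=
  ∀ o : Option α, (∀ a ∈ o, a ∈ A) → o ∈ range dec

/-- The elements of a finite set, in some order. -/
noncomputable def pick (C : Set α) (j : ℕ) : Option α :=
  open Classical in if h : C.Finite then h.toFinset.toList[j]? else none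

theorem mem_of_mem_pick (h : a ∈ pick C j) : a ∈ C := by
  unfold pick at h
  split_ifs at h with hC
  · simpa using List.mem_of_getElem? h
  · simp at h

theorem exists_mem_pick (hC : C.encard ≤ M) (ha : a ∈ C) : ∃ j < M, a ∈ pick C j := by
  have hfin := finite_of_encard_le_coe hC
  obtain ⟨j, hj, hja⟩ := List.mem_iff_getElem.1 (Finset.mem_toList.2 (hfin.mem_toFinset.2 ha))
  refine ⟨j, hj.trans_le ?_, ?_⟩
  · rwa [Finset.length_toList, ← Nat.cast_le (α := ℕ∞), ← hfin.encard_eq_coe_toFinset_card]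
  · rw [pick, dif_pos hfin, List.getElem?_eq_getElem hj, hja, Option.mem_some]

theorem exists_isDecoder (hA : A.encard + 1 ≤ (2 ^ β : ℕ)) :
    ∃ dec : (Fin β → Bool) → Option α, IsDecoder dec A := by
  have hoptions : ({o : Option α | ∀ a ∈ o, a ∈ A}).encard ≤ (2 ^ β : ℕ) := by
    have hle : (insert none (some '' A)).encard ≤ (2 ^ β : ℕ) :=
      (encard_insert_le _ _).trans ((add_le_add_left (encard_image_le _ _) 1).trans hA)
    refine (encard_mono fun o ho => ?_).trans hle
    cases o with
    | none => exact mem_insert _ _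
    | some a => exact mem_insert_of_mem _ (mem_image_of_mem _ (ho a rfl))
  obtain ⟨f, -, hf⟩ := (finite_of_encard_le_coe hoptions).exists_injOn_of_encard_le
    (t := (univ : Set (Fin β → Bool))) (by simpa using hoptions)
  exact ⟨_, fun o ho => ⟨f o, hf.leftInvOn_invFunOn ho⟩⟩

theorem mul_add_one_le_two_pow (hn : 2 ≤ n) (c d : ℕ) :
    (n ^ c + 1) * n ^ d + 1 ≤ 2 ^ ((c + d + 2) * Nat.clog 2 n) := by
  have hweight : n ^ c + 1 ≤ n ^ (c + 1) := Nat.pow_lt_pow_right hn c.lt_succ_self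
  calc (n ^ c + 1) * n ^ d + 1 ≤ n ^ (c + 1) * n ^ d + 1 := by gcongr
    _ = n ^ (c + d + 1) + 1 := by ring
    _ ≤ n ^ (c + d + 2) := Nat.pow_lt_pow_right hn (Nat.lt_succ_self _)
    _ ≤ (2 ^ Nat.clog 2 n) ^ (c + d + 2) := by gcongr; exact Nat.le_pow_clog one_lt_two n
    _ = 2 ^ ((c + d + 2) * Nat.clog 2 n) := by rw [← pow_mul, mul_comm]

theorem exists_isDecoder_of_mapsTo (hn : 2 ≤ n) {f : α → ℕ × κ} {K : Set κ}
    (hK : K.encard ≤ (n ^ d : ℕ)) (hf : InjOn f A) (hA : MapsTo f A (Iic (n ^ c) ×ˢ K)) :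
    ∃ dec : (Fin ((c + d + 2) * Nat.clog 2 n) → Bool) → Option α, IsDecoder dec A := by
  refine exists_isDecoder ?_
  calc A.encard + 1 ≤ (Iic (n ^ c) ×ˢ K).encard + 1 := by
        gcongr
        exact encard_le_encard_of_injOn hA hf
    _ = ((n ^ c + 1 : ℕ) : ℕ∞) * K.encard + 1 := by
        rw [encard_prod, ← Finset.coe_Iic, encard_coe_eq_coe_finsetCard, Nat.card_Iic]
    _ ≤ ((n ^ c + 1) * n ^ d + 1 : ℕ) := by
        push_cast at hK ⊢
        gcongr
    _ ≤ (2 ^ ((c + d + 2) * Nat.clog 2 n) : ℕ) := Nat.cast_le.2 (mul_add_one_le_two_pow hn c d)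

/-- The set whose elements are listed in the words `g`. -/
def decodedSet {ι : Type*} (dec : (Fin β → Bool) → Option α) (g : ι → Fin β → Bool) : Set α :=
  {a | ∃ i, a ∈ dec (g i)}

theorem IsDecoder.exists_decodedSet_eq {dec : (Fin β → Bool) → Option α} (hdec : IsDecoder dec A)
    (hCA : C ⊆ A) (hM : C.encard ≤ M) : ∃ g : Fin M → Fin β → Bool, decodedSet dec g = C := by
  choose g hg using fun j => hdec (pick C j) fun a ha => hCA (mem_of_mem_pick ha)
  refine ⟨fun i => g i, ext fun a => ?_⟩
  simp only [decodedSet, hg]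
  constructor
  · rintro ⟨i, hi⟩
    exact mem_of_mem_pick hi
  · intro ha
    obtain ⟨j, hj, hja⟩ := exists_mem_pick hM ha
    exact ⟨⟨j, hj⟩, hja⟩

end Encoding

/-! ## The clique algorithm -/

section Clique

/-- The elements that `pick` lists before position `j`. -/
def firstPicks {α : Type*} (C : Set α) (j : ℕ) : Set α := {a | ∃ i < j, a ∈ pick C i}

theorem firstPicks_zero {α : Type*} (C : Set α) : firstPicks C 0 = ∅ := by
  simp [firstPicks]

theorem firstPicks_succ {α : Type*} (C : Set α) (j : ℕ) :
    firstPicks C (j + 1) = firstPicks C j ∪ {a | a ∈ pick C j} := by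
  ext a
  simp only [firstPicks, mem_union, mem_ofPred_eq, Nat.lt_succ_iff_lt_or_eq, or_and_right,
    exists_or, exists_eq_left]

theorem firstPicks_eq_self {α : Type*} {C : Set α} {q : ℕ} (hC : C.encard ≤ q) :
    firstPicks C q = C :=
  Subset.antisymm (fun _ ⟨_, _, h⟩ => mem_of_mem_pick h) fun _ => exists_mem_pick hC

/-- The edges of a node. -/
def LocalInput.items (I : LocalInput) : Set (Item ℕ) :=
  {a | (a.endpoint, a.weight) ∈ I.incident}

/-- The state of a node: its input, the progress made before the current phase, the number of rounds
of this phase, and the lists announced so far in this phase. -/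
structure CliqueState where
  input : LocalInput
  progress : Progress ℕ
  round : ℕ
  heard : ℕ → Set (Item ℕ)

/-- Every phase takes `q` rounds, in which each node announces its candidates one by one. -/
noncomputable def cliqueAlgorithm {β : ℕ} (dec : (Fin β → Bool) → Option (Item ℕ)) (n s q : ℕ) :
    BCCAlgorithm β where
  State := CliqueState
  init I := ⟨I, .start, 0, fun _ => ∅⟩
  send σ := Function.invFun dec
    (pick (candidates σ.progress.clustering q σ.input.ident σ.input.items) σ.round)
  receive σ messages :=
    let heard y := σ.heard y ∪ {a | ∃ m, (y, m) ∈ messages ∧ a ∈ dec m}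
    if σ.round + 1 = q then ⟨σ.input, phase n s q σ.progress heard, 0, fun _ => ∅⟩
    else ⟨σ.input, σ.progress, σ.round + 1, heard⟩
  output σ := σ.progress.spanner

variable {n : ℕ} {G : SimpleGraph (Fin n)} {w : Sym2 (Fin n) → ℕ} {ident : Fin n → ℕ}

/-- The state of `v` after `t` phases and `j` further rounds. -/
noncomputable def cliqueStateAt (G : SimpleGraph (Fin n)) (w : Sym2 (Fin n) → ℕ)
    (ident : Fin n → ℕ) (s q t j : ℕ) (v : Fin n) : CliqueState where
  input := localInput G w ident v
  progress := phases (renamedEdges G w ident) n s q t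
  round := j
  heard y := firstPicks (candidateLists (phases (renamedEdges G w ident) n s q t).clustering q
    (renamedEdges G w ident) y) j

variable {β s q : ℕ} {dec : (Fin β → Bool) → Option (Item ℕ)} {A : Set (Item ℕ)}
  {f : Clustering ℕ} {v : Fin n}

theorem items_localInput (hid : ident.Injective) :
    (localInput G w ident v).items = incidentItems (renamedEdges G w ident) (ident v) := by
  ext a
  refine Iff.trans ?_ (mem_renamedEdges hid).symm
  simp only [LocalInput.items, localInput, mem_ofPred_eq, Prod.mk.injEq]

theorem candidateLists_eq_empty {y : ℕ} (hy : y ∉ range ident) :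
    candidateLists f q (renamedEdges G w ident) y = ∅ :=
  eq_empty_of_forall_notMem fun _ ha =>
    hy (mem_range_of_mem_renamedEdges (mem_of_mem_candidateLists ha) (Sym2.mem_mk_left _ _))

theorem firstPicks_candidateLists {E : Set (Sym2 ℕ × ℕ)} (y : ℕ) :
    firstPicks (candidateLists f q E y) q = candidateLists f q E y :=
  firstPicks_eq_self encard_lightest_le

theorem setOf_message_eq_setOf_pick (hdec : IsDecoder dec A)
    (hA : ∀ y, incidentItems (renamedEdges G w ident) y ⊆ A) (j y : ℕ) :
    {a | ∃ m, (y, m) ∈ range (fun u => (ident u, Function.invFun dec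
      (pick (candidateLists f q (renamedEdges G w ident) (ident u)) j))) ∧ a ∈ dec m} =
      {a | a ∈ pick (candidateLists f q (renamedEdges G w ident) y) j} := by
  have hpick (y : ℕ) : dec (Function.invFun dec (pick
      (candidateLists f q (renamedEdges G w ident) y) j)) = pick (candidateLists f q _ y) j :=
    Function.invFun_eq (hdec _ fun _ ha => hA y (mem_of_mem_candidateLists (mem_of_mem_pick ha)))
  ext a
  constructor
  · rintro ⟨_, ⟨u, hu⟩, ha⟩
    obtain ⟨rfl, rfl⟩ := Prod.ext_iff.1 hu
    exact hpick (ident u) ▸ ha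
  · intro ha
    obtain ⟨u, rfl⟩ : y ∈ range ident := by_contra fun hy =>
      notMem_empty a (candidateLists_eq_empty hy ▸ mem_of_mem_pick ha)
    exact ⟨_, ⟨u, rfl⟩, (hpick _).symm ▸ ha⟩

theorem cliqueAlgorithm_receive (hid : ident.Injective) (hdec : IsDecoder dec A)
    (hA : ∀ y, incidentItems (renamedEdges G w ident) y ⊆ A) (t j : ℕ) (v : Fin n) :
    (cliqueAlgorithm dec n s q).receive (cliqueStateAt G w ident s q t j v)
        (range fun u => (ident u, (cliqueAlgorithm dec n s q).send
          (cliqueStateAt G w ident s q t j u))) =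
      if j + 1 = q then cliqueStateAt G w ident s q (t + 1) 0 v
      else cliqueStateAt G w ident s q t (j + 1) v := by
  have hlists (u : Fin n) : candidates (phases (renamedEdges G w ident) n s q t).clustering q
      (localInput G w ident u).ident (localInput G w ident u).items =
        candidateLists (phases (renamedEdges G w ident) n s q t).clustering q
          (renamedEdges G w ident) (ident u) := by
    rw [items_localInput hid]
    rfl
  simp only [cliqueAlgorithm, cliqueStateAt, hlists, setOf_message_eq_setOf_pick hdec hA,
    ← firstPicks_succ, firstPicks_zero]
  split_ifs with hj
  · simp only [hj, firstPicks_candidateLists]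
    rfl
  · rfl

theorem cliqueAlgorithm_run (hq : 0 < q) (hid : ident.Injective) (hdec : IsDecoder dec A)
    (hA : ∀ y, incidentItems (renamedEdges G w ident) y ⊆ A) (T : ℕ) :
    (cliqueAlgorithm dec n s q).run G w ident T =
      cliqueStateAt G w ident s q (T / q) (T % q) := by
  induction T with
  | zero =>
    ext1 v
    rw [Nat.zero_div, Nat.zero_mod, cliqueStateAt]
    simp only [firstPicks_zero]
    rfl
  | succ T ih =>
    ext1 v
    rw [BCCAlgorithm.run, ih, cliqueAlgorithm_receive hid hdec hA]
    split_ifs with hT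
    · obtain ⟨hdiv, hmod⟩ := (Nat.div_mod_unique (a := T + 1) (d := T / q + 1) (c := 0) hq).2
        ⟨by rw [mul_add]; have := Nat.div_add_mod T q; omega, hq⟩
      rw [hdiv, hmod]
    · obtain ⟨hdiv, hmod⟩ := (Nat.div_mod_unique (a := T + 1) (d := T / q) (c := T % q + 1) hq).2
        ⟨by have := Nat.div_add_mod T q; omega, by have := Nat.mod_lt T hq; omega⟩
      rw [hdiv, hmod]

theorem cliqueAlgorithm_output (hq : 0 < q) (hid : ident.Injective) (hdec : IsDecoder dec A)
    (hA : ∀ y, incidentItems (renamedEdges G w ident) y ⊆ A) (t : ℕ) (v : Fin n) :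
    (cliqueAlgorithm dec n s q).output ((cliqueAlgorithm dec n s q).run G w ident (t * q) v) =
      (phases (renamedEdges G w ident) n s q t).spanner := by
  rw [cliqueAlgorithm_run hq hid hdec hA, Nat.mul_div_cancel t hq]
  rfl

end Clique

/-! ## The streaming algorithm -/

section Mergeability

variable {V : Type*} {f : Clustering V} {q : ℕ} {v : V}

theorem live_union (I J : Set (Item V)) : live f v (I ∪ J) = live f v I ∪ live f v J :=
  sep_union ..

variable [LinearOrder V] [WellFoundedLT V]

theorem candidates_candidates_union (I J : Set (Item V)) :
    candidates f q v (candidates f q v I ∪ J) = candidates f q v (I ∪ J) := by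
  have hlive : live f v (candidates f q v I) = candidates f q v I :=
    sep_eq_self_iff_mem_true.2 fun _ ha => (candidates_subset_live ha).2
  calc candidates f q v (candidates f q v I ∪ J)
      = lightest f.itemCenter q (lightest f.itemCenter q (live f v I) ∪ live f v J) := by
        rw [candidates, live_union, hlive, candidates]
    _ = candidates f q v (I ∪ J) := by rw [lightest_lightest_union, ← live_union, candidates]

theorem candidates_candidateLists_union (E F : Set (Sym2 V × ℕ)) (v : V) :
    candidates f q v (candidateLists f q E v ∪ incidentItems F v) = candidateLists f q (E ∪ F) v :=
  candidates_candidates_union _ _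

end Mergeability

section Streaming

variable {n S β s q k M W c t : ℕ}

/-- What is stored between two stream items: the progress made before the current pass, and the
lists of candidates among the edges seen in this pass. -/
structure StreamState (n : ℕ) where
  progress : Progress (Fin n)
  lists : Fin n → Set (Item (Fin n))

/-- Each pass computes the lists of candidates and ends with one phase. The states are stored in the
memory by means of `D`. -/
noncomputable def streamingAlgorithm (D : Memory S β → StreamState n) (s q : ℕ) :
    StreamingAlgorithm n S β where
  init := Function.invFun D ⟨.start, fun _ => ∅⟩
  step m e := Function.invFun D ⟨(D m).progress, fun v =>
    candidates (D m).progress.clustering q v ((D m).lists v ∪ incidentItems {e} v)⟩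
  endPass m := Function.invFun D ⟨phase n s q (D m).progress (D m).lists, fun _ => ∅⟩
  output m := (D m).progress.spanner

/-- The state after `t` passes if the current pass has seen the edges `L`. -/
noncomputable def streamStateAt (E : Set (Sym2 (Fin n) × ℕ)) (s q t : ℕ)
    (L : Set (Sym2 (Fin n) × ℕ)) : StreamState n where
  progress := phases E n s q t
  lists := candidateLists (phases E n s q t).clustering q L

variable {D : Memory S β → StreamState n} {E L : Set (Sym2 (Fin n) × ℕ)}
  {e : Sym2 (Fin n) × ℕ} {stream : List (Sym2 (Fin n) × ℕ)} {m : Memory S β}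

theorem streamStateAt_empty :
    streamStateAt E s q t ∅ = ⟨phases E n s q t, fun _ => ∅⟩ := by
  have hlists (v : Fin n) : candidateLists (phases E n s q t).clustering q ∅ v = ∅ :=
    eq_empty_of_forall_notMem fun _ ha => notMem_empty _ (mem_of_mem_candidateLists ha)
  exact congrArg _ (funext hlists)

theorem streamingAlgorithm_step (hL : streamStateAt E s q t (L ∪ {e}) ∈ range D)
    (hm : D m = streamStateAt E s q t L) :
    D ((streamingAlgorithm D s q).step m e) = streamStateAt E s q t (L ∪ {e}) := by
  rw [← Function.invFun_eq hL]
  simp only [streamingAlgorithm, hm, streamStateAt, candidates_candidateLists_union]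

theorem streamingAlgorithm_foldl (hD : ∀ L ⊆ E, streamStateAt E s q t L ∈ range D)
    (hstream : {e | e ∈ stream} ⊆ E) (hL : L ⊆ E) (hm : D m = streamStateAt E s q t L) :
    D (stream.foldl (streamingAlgorithm D s q).step m) =
      streamStateAt E s q t (L ∪ {e | e ∈ stream}) := by
  induction stream generalizing L m with
  | nil => simpa using hm
  | cons e stream ih =>
    have hinsert : L ∪ {x | x ∈ e :: stream} = L ∪ {e} ∪ {x | x ∈ stream} := by
      rw [union_assoc]
      congr 1
      ext x
      simp
    have hLe : L ∪ {e} ⊆ E := union_subset hL (singleton_subset_iff.2 (hstream List.mem_cons_self))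
    rw [List.foldl_cons, hinsert]
    exact ih (fun x hx => hstream (List.mem_cons_of_mem _ hx)) hLe
      (streamingAlgorithm_step (hD _ hLe) hm)

theorem streamingAlgorithm_endPass (hD : streamStateAt E s q (t + 1) ∅ ∈ range D)
    (hm : D m = streamStateAt E s q t E) :
    D ((streamingAlgorithm D s q).endPass m) = streamStateAt E s q (t + 1) ∅ := by
  rw [streamStateAt_empty] at hD ⊢
  rw [← Function.invFun_eq hD]
  simp only [streamingAlgorithm, hm]
  rfl

theorem streamingAlgorithm_run (hD : ∀ t ≤ k, ∀ L ⊆ E, streamStateAt E s q t L ∈ range D)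
    (hstream : {e | e ∈ stream} = E) :
    ∀ t ≤ k, D ((streamingAlgorithm D s q).run stream t) = streamStateAt E s q t ∅
  | 0, _ => by
    have hstart := hD 0 zero_le ∅ (empty_subset E)
    rw [streamStateAt_empty] at hstart ⊢
    exact Function.invFun_eq hstart
  | t + 1, ht => by
    have hpass := streamingAlgorithm_foldl (hD t (by omega)) hstream.subset (empty_subset E)
      (streamingAlgorithm_run hD hstream t (by omega))
    rw [hstream, empty_union] at hpass
    exact streamingAlgorithm_endPass (hD (t + 1) ht ∅ (empty_subset E)) hpass

theorem streamingAlgorithm_output (hD : ∀ t ≤ k, ∀ L ⊆ E, streamStateAt E s q t L ∈ range D)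
    (hstream : {e | e ∈ stream} = E) :
    (streamingAlgorithm D s q).output ((streamingAlgorithm D s q).run stream k) =
      (phases E n s q k).spanner :=
  congrArg (·.progress.spanner) (streamingAlgorithm_run hD hstream k le_rfl)

/-- The states that occur when the weights are at most `W` and the spanner has at most `M`
edges. -/
structure StreamState.Bounded (M q W : ℕ) (σ : StreamState n) : Prop where
  radius_le : ∀ v, σ.progress.clustering.radius v ≠ ⊤ → σ.progress.clustering.radius v ≤ W
  spanner_le : ∀ e ∈ σ.progress.spanner, e.2 ≤ W
  encard_spanner_le : σ.progress.spanner.encard ≤ M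
  lists_le : ∀ v, ∀ a ∈ σ.lists v, a.weight ≤ W
  encard_lists_le : ∀ v, (σ.lists v).encard ≤ q

theorem bounded_streamStateAt (hR : ∀ f, ∃ R, GoodSample n s q f (candidateLists f q E) R)
    (hW : ∀ e ∈ E, e.2 ≤ W) (ht : t ≤ k) (hL : L ⊆ E) :
    (streamStateAt E s q t L).Bounded (k * (9 * n * s)) q W where
  radius_le := radius_phases_le hW t
  spanner_le e he := hW e ((phaseInvariant_phases hR t ht).subset he)
  encard_spanner_le := (encard_spanner_phases_le hR t).trans
    (Nat.cast_le.2 (Nat.mul_le_mul_right _ ht))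
  lists_le _ _ ha := hW _ (hL (mem_of_mem_candidateLists ha))
  encard_lists_le _ := encard_lightest_le

theorem exists_isDecoder_item (hn : 2 ≤ n) (c : ℕ) :
    ∃ dec : (Fin ((c + 4) * Nat.clog 2 n) → Bool) → Option (Item (Fin n)),
      IsDecoder dec {a | a.weight ≤ n ^ c} := by
  refine exists_isDecoder_of_mapsTo (d := 2) hn (f := ofLex) (K := univ) ?_ ofLex.injective.injOn
    fun a ha => ⟨ha, mem_univ _⟩
  rw [encard_univ, ENat.card_eq_coe_fintype_card, Fintype.card_fin, Nat.cast_le]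
  exact Nat.le_self_pow two_ne_zero n

theorem exists_isDecoder_edge (hn : 2 ≤ n) (c : ℕ) :
    ∃ dec : (Fin ((c + 4) * Nat.clog 2 n) → Bool) → Option (Sym2 (Fin n) × ℕ),
      IsDecoder dec {e | e.2 ≤ n ^ c} := by
  refine exists_isDecoder_of_mapsTo (d := 2) hn (f := Prod.swap) (K := univ) ?_
    Prod.swap_injective.injOn fun a ha => ⟨ha, mem_univ _⟩
  rw [encard_univ, ENat.card_eq_coe_fintype_card, Nat.cast_le]
  calc Fintype.card (Sym2 (Fin n)) ≤ Fintype.card (Fin n × Fin n) :=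
        Fintype.card_le_of_surjective _ Sym2.mk_surjective
    _ = n ^ 2 := by rw [Fintype.card_prod, Fintype.card_fin, sq]

theorem exists_isDecoder_cluster (hn : 2 ≤ n) (c : ℕ) :
    ∃ dec : (Fin ((c + 4) * Nat.clog 2 n) → Bool) → Option (Fin n × ℕ∞),
      IsDecoder dec {x | x.2 ≠ ⊤ → x.2 ≤ (n ^ c : ℕ)} := by
  refine exists_isDecoder_of_mapsTo (d := 2) hn (K := univ)
    (f := fun x => (x.2.toNat, x.1, x.2 = ⊤)) ?_ (fun x _ y _ hxy => ?_)
    fun x hx => ⟨?_, mem_univ _⟩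
  · rw [encard_univ, ENat.card_eq_coe_fintype_card, Nat.cast_le, Fintype.card_prod,
      Fintype.card_fin, Fintype.card_prop, sq]
    exact Nat.mul_le_mul_left n hn
  · simp only [Prod.mk.injEq, eq_iff_iff] at hxy
    obtain ⟨hradius, hcenter, htop⟩ := hxy
    refine Prod.ext hcenter ?_
    rcases eq_or_ne x.2 ⊤ with hx | hx
    · rw [hx, htop.1 hx]
    · rw [← ENat.natCast_toNat hx, hradius, ENat.natCast_toNat (mt htop.2 hx)]
  · rcases eq_or_ne x.2 ⊤ with htop | htop
    · simp [htop]
    · exact ENat.toNat_le_of_le_natCast (hx htop)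

theorem exists_memory_decoder (hn : 2 ≤ n) (c M q : ℕ) :
    ∃ D : Memory (n + (M + n * q)) ((c + 4) * Nat.clog 2 n) → StreamState n,
      ∀ σ : StreamState n, σ.Bounded M q (n ^ c) → σ ∈ range D := by
  obtain ⟨cluster, hcluster⟩ := exists_isDecoder_cluster hn c
  obtain ⟨edge, hedge⟩ := exists_isDecoder_edge hn c
  obtain ⟨item, hitem⟩ := exists_isDecoder_item hn c
  let layout : Fin n ⊕ (Fin M ⊕ Fin n × Fin q) ≃ Fin (n + (M + n * q)) :=
    Fintype.equivFinOfCardEq (by simp)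
  refine ⟨fun m => ⟨⟨⟨fun v => ((cluster (m (layout (.inl v)))).getD (v, ⊤)).1,
    fun v => ((cluster (m (layout (.inl v)))).getD (v, ⊤)).2⟩,
    decodedSet edge fun i => m (layout (.inr (.inl i)))⟩,
    fun v => decodedSet item fun j => m (layout (.inr (.inr (v, j))))⟩, fun σ hσ => ?_⟩
  choose clusters hclusters using fun v =>
    hcluster (some (σ.progress.clustering.center v, σ.progress.clustering.radius v))
      (by rintro _ ⟨⟩; exact hσ.radius_le v)
  obtain ⟨edges, hedges⟩ := hedge.exists_decodedSet_eq hσ.spanner_le hσ.encard_spanner_le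
  choose items hitems using fun v =>
    hitem.exists_decodedSet_eq (hσ.lists_le v) (hσ.encard_lists_le v)
  refine ⟨fun i => Sum.elim clusters (Sum.elim edges fun p => items p.1 p.2) (layout.symm i), ?_⟩
  simp only [Equiv.symm_apply_apply, Sum.elim_inl, Sum.elim_inr, hclusters, hedges, hitems,
    Option.getD_some]

end Streaming

/-! ## Parameters -/

section Parameters

variable {n k s q : ℕ}

/-- The sampling rate `1 / s` and the length `q` of the lists are suitable for `k` phases on `n`
nodes: no cluster survives all phases, good samples exist, and `s` and `q` are of the order of
`n ^ (1 / k)` and `n ^ (1 / k) * log n`. -/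
structure Admissible (n k s q : ℕ) : Prop where
  pos : 0 < s
  lt_pow : n < s ^ k
  mul_one_sub_pow_lt : n * (1 - 1 / (3 * s) : ℝ) ^ q < 1 / 3
  rate_le : s ≤ 2 * (n : ℝ) ^ (1 / (k : ℝ))
  length_le : q ≤ 36 * ((n : ℝ) ^ (1 / (k : ℝ)) * Real.log n)

theorem exists_lt_pow_le_two_mul_rpow (hn : 1 ≤ n) (hk : k ≠ 0) :
    ∃ s : ℕ, 0 < s ∧ n < s ^ k ∧ s ≤ 2 * (n : ℝ) ^ (1 / (k : ℝ)) := by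
  set x := (n : ℝ) ^ (1 / (k : ℝ)) with hx
  have hx1 : 1 ≤ x := Real.one_le_rpow (Nat.one_le_cast.2 hn) (by positivity)
  have hxk : x ^ k = n := by rw [hx, one_div, Real.rpow_inv_natCast_pow (by positivity) hk]
  refine ⟨⌊x⌋₊ + 1, Nat.succ_pos _, ?_, ?_⟩
  · have hlt : x ^ k < ((⌊x⌋₊ + 1 : ℕ) : ℝ) ^ k :=
      pow_lt_pow_left₀ (by exact_mod_cast Nat.lt_floor_add_one x) (by positivity) hk
    rw [hxk] at hlt
    exact_mod_cast hlt
  · push_cast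
    linarith [Nat.floor_le (zero_le_one.trans hx1)]

theorem one_sub_one_div_pow_le_half (hs : 0 < s) : (1 - 1 / s : ℝ) ^ s ≤ 1 / 2 :=
  calc (1 - 1 / s : ℝ) ^ s ≤ Real.exp (-1) := Real.one_sub_div_pow_le_exp_neg (by exact_mod_cast hs)
    _ ≤ 1 / 2 := by
      rw [Real.exp_neg, one_div]
      exact inv_anti₀ two_pos (by linarith [Real.add_one_le_exp 1])

theorem mul_one_sub_pow_lt_one_third (hs : 0 < s) :
    (n : ℝ) * (1 - 1 / (3 * s)) ^ (3 * s * (Nat.clog 2 n + 2)) < 1 / 3 := by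
  have hhalf : (1 - 1 / (3 * s) : ℝ) ^ (3 * s) ≤ 1 / 2 := by
    exact_mod_cast one_sub_one_div_pow_le_half (s := 3 * s) (by omega)
  have hn : (n : ℝ) ≤ 2 ^ Nat.clog 2 n := by exact_mod_cast Nat.le_pow_clog one_lt_two n
  have hnonneg : (0 : ℝ) ≤ (1 - 1 / (3 * s)) ^ (3 * s) := by
    have hsR : (1 : ℝ) ≤ s := Nat.one_le_cast.2 hs
    exact pow_nonneg (sub_nonneg.2 ((div_le_one (by positivity)).2 (by linarith))) _
  calc (n : ℝ) * (1 - 1 / (3 * s)) ^ (3 * s * (Nat.clog 2 n + 2))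
      ≤ 2 ^ Nat.clog 2 n * (1 / 2) ^ (Nat.clog 2 n + 2) := by
        rw [pow_mul]
        gcongr
    _ = 1 / 4 := by
        rw [pow_add, ← mul_assoc, ← mul_pow]
        norm_num
    _ < 1 / 3 := by norm_num

theorem clog_two_add_two_le (hn : 2 ≤ n) : (Nat.clog 2 n + 2 : ℝ) ≤ 6 * Real.log n := by
  have hlog2 : (0.69 : ℝ) ≤ Real.log 2 := by linarith [Real.log_two_gt_d9]
  have hlog : Real.log 2 ≤ Real.log n := Real.log_le_log two_pos (by exact_mod_cast hn)
  have hclog : ((Nat.clog 2 n - 1 : ℕ) : ℝ) * Real.log 2 ≤ Real.log n := by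
    rw [← Real.log_pow]
    exact Real.log_le_log (by positivity)
      (by exact_mod_cast (Nat.pow_pred_clog_lt_self one_lt_two hn).le)
  have hone : 1 ≤ Nat.clog 2 n := Nat.clog_pos one_lt_two hn
  rw [Nat.cast_sub hone, Nat.cast_one] at hclog
  nlinarith

theorem exists_admissible (hn : 2 ≤ n) (hk : k ≠ 0) : ∃ s q, Admissible n k s q := by
  obtain ⟨s, hs, hlt, hle⟩ := exists_lt_pow_le_two_mul_rpow (one_le_two.trans hn) hk
  refine ⟨s, 3 * s * (Nat.clog 2 n + 2), hs, hlt, mul_one_sub_pow_lt_one_third hs, hle, ?_⟩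
  calc ((3 * s * (Nat.clog 2 n + 2) : ℕ) : ℝ) = 3 * s * (Nat.clog 2 n + 2) := by push_cast; rfl
    _ ≤ 3 * (2 * (n : ℝ) ^ (1 / (k : ℝ))) * (6 * Real.log n) :=
      mul_le_mul (mul_le_mul_of_nonneg_left hle three_pos.le) (clog_two_add_two_le hn)
        (by positivity) (by positivity)
    _ = 36 * ((n : ℝ) ^ (1 / (k : ℝ)) * Real.log n) := by ring

theorem Admissible.length_pos (h : Admissible n k s q) (hn : 0 < n) : 0 < q := by
  refine Nat.pos_of_ne_zero ?_
  rintro rfl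
  have hnR : (1 : ℝ) ≤ n := Nat.one_le_cast.2 hn
  have hlt := h.mul_one_sub_pow_lt
  rw [pow_zero] at hlt
  linarith

theorem rpow_one_add_one_div (hn : n ≠ 0) :
    (n : ℝ) ^ (1 + 1 / (k : ℝ)) = n * (n : ℝ) ^ (1 / (k : ℝ)) :=
  Real.rpow_one_add' (by positivity) (by positivity)

theorem Admissible.rounds_le (h : Admissible n k s q) :
    ((k * q : ℕ) : ℝ) ≤ 36 * (k * (n : ℝ) ^ (1 / (k : ℝ)) * Real.log n) :=
  calc ((k * q : ℕ) : ℝ) = k * q := Nat.cast_mul ..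
    _ ≤ k * (36 * ((n : ℝ) ^ (1 / (k : ℝ)) * Real.log n)) := by gcongr; exact h.length_le
    _ = 36 * (k * (n : ℝ) ^ (1 / (k : ℝ)) * Real.log n) := by ring

theorem Admissible.size_le (h : Admissible n k s q) (hn : n ≠ 0) :
    ((k * (9 * n * s) : ℕ) : ℝ) ≤ 18 * (k * (n : ℝ) ^ (1 + 1 / (k : ℝ))) :=
  calc ((k * (9 * n * s) : ℕ) : ℝ) = k * (9 * n * s) := by push_cast; rfl
    _ ≤ k * (9 * n * (2 * (n : ℝ) ^ (1 / (k : ℝ)))) := by gcongr; exact h.rate_le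
    _ = 18 * (k * (n : ℝ) ^ (1 + 1 / (k : ℝ))) := by rw [rpow_one_add_one_div hn]; ring

theorem Admissible.words_le (h : Admissible n k s q) (hn : n ≠ 0) (hk : 1 ≤ k) :
    ((n + (k * (9 * n * s) + n * q) : ℕ) : ℝ) ≤
      36 * ((k + Real.log n) * (n : ℝ) ^ (1 + 1 / (k : ℝ))) := by
  have hclusters : (n : ℝ) ≤ k * (n : ℝ) ^ (1 + 1 / (k : ℝ)) :=
    calc (n : ℝ) ≤ n ^ (1 + 1 / (k : ℝ)) := Real.self_le_rpow_of_one_le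
          (Nat.one_le_cast.2 (Nat.pos_of_ne_zero hn)) (le_add_of_nonneg_right (by positivity))
      _ ≤ k * (n : ℝ) ^ (1 + 1 / (k : ℝ)) :=
        le_mul_of_one_le_left (by positivity) (Nat.one_le_cast.2 hk)
  have hlists : (n * q : ℝ) ≤ 36 * (Real.log n * (n : ℝ) ^ (1 + 1 / (k : ℝ))) :=
    calc (n * q : ℝ) ≤ n * (36 * ((n : ℝ) ^ (1 / (k : ℝ)) * Real.log n)) := by
          gcongr
          exact h.length_le
      _ = 36 * (Real.log n * (n : ℝ) ^ (1 + 1 / (k : ℝ))) := by rw [rpow_one_add_one_div hn]; ring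
  calc ((n + (k * (9 * n * s) + n * q) : ℕ) : ℝ) = n + (((k * (9 * n * s) : ℕ) : ℝ) + n * q) := by
        rw [Nat.cast_add, Nat.cast_add, Nat.cast_mul n q]
    _ ≤ 36 * ((k + Real.log n) * (n : ℝ) ^ (1 + 1 / (k : ℝ))) := by
        linarith [h.size_le hn, (Nat.cast_nonneg n).trans hclusters]

end Parameters

section Main

/-- In the broadcast congested clique on `n` nodes, for all edge weights up to `W` and identifiers
below `N`, all nodes output after `T` rounds the same `(2 * k - 1)`-spanner with at most `m`
edges. -/
def BCCAlgorithm.ComputesSpanners {β : ℕ} (A : BCCAlgorithm β) (n k T W N : ℕ) (m : ℝ) : Prop :=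
  ∀ (G : SimpleGraph (Fin n)) (w : Sym2 (Fin n) → ℕ) (ident : Fin n → ℕ),
    (∀ e ∈ G.edgeSet, w e ≤ W) → ident.Injective → (∀ v, ident v < N) →
    ∃ H : SimpleGraph (Fin n), IsSpanner (2 * k - 1) G w H ∧ H.edgeSet.ncard ≤ m ∧
      ∀ v, A.output (A.run G w ident T v) = identEdges H w ident

/-- For all edge weights up to `W` and all edge streams, the algorithm outputs after `k` passes a
`(2 * k - 1)`-spanner with at most `m` edges. -/
def StreamingAlgorithm.ComputesSpanners {n S β : ℕ} (A : StreamingAlgorithm n S β) (k W : ℕ)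
    (m : ℝ) : Prop :=
  ∀ (G : SimpleGraph (Fin n)) (w : Sym2 (Fin n) → ℕ) (stream : List (Sym2 (Fin n) × ℕ)),
    (∀ e ∈ G.edgeSet, w e ≤ W) → IsEdgeStream G w stream →
    ∃ H : SimpleGraph (Fin n), IsSpanner (2 * k - 1) G w H ∧ H.edgeSet.ncard ≤ m ∧
      A.output (A.run stream k) = weightedEdges H w

variable {n k s q : ℕ} {G : SimpleGraph (Fin n)} {w : Sym2 (Fin n) → ℕ}

section RenamedEdges

variable {V : Type*} [LinearOrder V] {ident : Fin n → V}

theorem mem_image_of_mem_renamedEdges {e : Sym2 V × ℕ} (he : e ∈ renamedEdges G w ident) {y : V}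
    (hy : y ∈ e.1) : y ∈ Finset.univ.image ident :=
  mem_image_univ_iff_mem_range.2 (mem_range_of_mem_renamedEdges he hy)

theorem card_image_univ_le (ident : Fin n → V) : #(Finset.univ.image ident) ≤ n :=
  Finset.card_image_le.trans_eq (Finset.card_fin n)

theorem Admissible.exists_goodSample (h : Admissible n k s q) (hn : 0 < n) (f : Clustering V) :
    ∃ R, GoodSample n s q f (candidateLists f q (renamedEdges G w ident)) R :=
  exists_goodSample_candidateLists (card_image_univ_le ident) hn h.pos h.mul_one_sub_pow_lt
    fun _ he _ => mem_image_of_mem_renamedEdges he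

theorem Admissible.exists_isSpanner [WellFoundedLT V] (h : Admissible n k s q) (hn : 0 < n)
    (hk : 1 ≤ k) (hid : ident.Injective) :
    ∃ H : SimpleGraph (Fin n), IsSpanner (2 * k - 1) G w H ∧
      H.edgeSet.ncard ≤ 36 * (k * (n : ℝ) ^ (1 + 1 / (k : ℝ))) ∧
      (phases (renamedEdges G w ident) n s q k).spanner = renamedEdges H w ident := by
  have hR := h.exists_goodSample (G := G) (w := w) (ident := ident) hn
  obtain ⟨H, hH, hcard, hedges⟩ := DistSpanner.exists_isSpanner hid (l := 2 * k - 1) (by omega)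
    (phaseInvariant_phases hR k le_rfl).subset fun _ _ _ => reach_phases (card_image_univ_le ident)
      (fun _ he _ => mem_image_of_mem_renamedEdges he) hR (by omega) h.lt_pow
  refine ⟨H, hH, ?_, hedges⟩
  calc (H.edgeSet.ncard : ℝ) ≤ (k * (9 * n * s) : ℕ) :=
        Nat.cast_le.2 (ENat.toNat_le_of_le_natCast (hcard.trans_le (encard_spanner_phases_le hR k)))
    _ ≤ 18 * (k * (n : ℝ) ^ (1 + 1 / (k : ℝ))) := h.size_le hn.ne'
    _ ≤ 36 * (k * (n : ℝ) ^ (1 + 1 / (k : ℝ))) := by gcongr; norm_num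

end RenamedEdges

theorem incidentItems_renamedEdges_subset {ident : Fin n → ℕ} {W N : ℕ}
    (hw : ∀ e ∈ G.edgeSet, w e ≤ W) (hN : ∀ v, ident v < N) (y : ℕ) :
    incidentItems (renamedEdges G w ident) y ⊆ {a | a.weight ≤ W ∧ a.endpoint < N} := by
  intro a ha
  obtain ⟨v, hv⟩ := mem_range_of_mem_renamedEdges ha (Sym2.mem_mk_right _ _)
  obtain ⟨e, he, heq⟩ := ha
  exact ⟨(Prod.ext_iff.1 heq).2.symm.trans_le (hw e he), (hv ▸ hN v : a.endpoint < N)⟩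

theorem Admissible.cliqueAlgorithm_computesSpanners (h : Admissible n k s q) (hn : 0 < n)
    (hk : 1 ≤ k) {β W N : ℕ} {dec : (Fin β → Bool) → Option (Item ℕ)}
    (hdec : IsDecoder dec {a | a.weight ≤ W ∧ a.endpoint < N}) :
    (cliqueAlgorithm dec n s q).ComputesSpanners n k (k * q) W N
      (36 * (k * (n : ℝ) ^ (1 + 1 / (k : ℝ)))) := by
  intro G w ident hw hid hN
  obtain ⟨H, hH, hcard, hedges⟩ := h.exists_isSpanner (G := G) (w := w) hn hk hid
  refine ⟨H, hH, hcard, fun v => ?_⟩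
  rw [cliqueAlgorithm_output (h.length_pos hn) hid hdec (incidentItems_renamedEdges_subset hw hN),
    hedges, identEdges_eq_renamedEdges]

theorem exists_bccAlgorithm (c d n k : ℕ) (hk : 1 ≤ k) :
    ∃ (A : BCCAlgorithm ((c + d + 2) * Nat.clog 2 n)) (T : ℕ),
      T ≤ 36 * (k * (n : ℝ) ^ (1 / (k : ℝ)) * Real.log n) ∧
      A.ComputesSpanners n k T (n ^ c) (n ^ d) (36 * (k * (n : ℝ) ^ (1 + 1 / (k : ℝ)))) := by
  rcases le_or_gt n 1 with hn | hn
  · have := Fin.subsingleton_iff_le_one.2 hn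
    have := Real.log_natCast_nonneg n
    refine ⟨⟨Unit, fun _ => (), fun _ _ => false, fun _ _ => (), fun _ => ∅⟩, 0, ?_,
      fun G w ident _ _ _ => ⟨⊥, isSpanner_bot_of_subsingleton _ G w, ?_, fun _ => ?_⟩⟩
    · rw [Nat.cast_zero]
      positivity
    · rw [SimpleGraph.edgeSet_bot, ncard_empty, Nat.cast_zero]
      positivity
    · simp [identEdges]
  · obtain ⟨s, q, h⟩ := exists_admissible hn (k := k) (by omega)
    have hcard : (Iio (n ^ d)).encard ≤ (n ^ d : ℕ) := by
      rw [← Finset.coe_Iio, encard_coe_eq_coe_finsetCard, Nat.card_Iio]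
    obtain ⟨dec, hdec⟩ := exists_isDecoder_of_mapsTo (c := c) hn hcard ofLex.injective.injOn
      (A := {a : Item ℕ | a.weight ≤ n ^ c ∧ a.endpoint < n ^ d}) fun a ha => ha
    exact ⟨cliqueAlgorithm dec n s q, k * q, h.rounds_le,
      h.cliqueAlgorithm_computesSpanners (by omega) hk hdec⟩

theorem Admissible.streamingAlgorithm_computesSpanners (h : Admissible n k s q) (hn : 0 < n)
    (hk : 1 ≤ k) {S β W : ℕ} {D : Memory S β → StreamState n}
    (hD : ∀ σ : StreamState n, σ.Bounded (k * (9 * n * s)) q W → σ ∈ range D) :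
    (streamingAlgorithm D s q).ComputesSpanners k W (36 * (k * (n : ℝ) ^ (1 + 1 / (k : ℝ)))) := by
  intro G w stream hw hstream
  obtain ⟨H, hH, hcard, hedges⟩ := h.exists_isSpanner (G := G) (w := w) hn hk Function.injective_id
  have hweight : ∀ e ∈ renamedEdges G w id, e.2 ≤ W := forall_mem_image.2 hw
  refine ⟨H, hH, hcard, ?_⟩
  rw [weightedEdges_eq_renamedEdges, ← hedges]
  refine streamingAlgorithm_output (fun t ht L hL => hD _ (bounded_streamStateAt
    (h.exists_goodSample hn) hweight ht hL)) (ext fun e => ?_)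
  rw [← weightedEdges_eq_renamedEdges]
  exact hstream.2 e

theorem exists_streamingAlgorithm (c n k : ℕ) (hk : 1 ≤ k) :
    ∃ (S : ℕ) (A : StreamingAlgorithm n S ((c + 4) * Nat.clog 2 n)),
      S ≤ 36 * ((k + Real.log n) * (n : ℝ) ^ (1 + 1 / (k : ℝ))) ∧
      A.ComputesSpanners k (n ^ c) (36 * (k * (n : ℝ) ^ (1 + 1 / (k : ℝ)))) := by
  rcases le_or_gt n 1 with hn | hn
  · have := Fin.subsingleton_iff_le_one.2 hn
    have := Real.log_natCast_nonneg n
    refine ⟨0, ⟨fun _ _ => false, fun m _ => m, id, fun _ => ∅⟩, ?_,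
      fun G w stream _ _ => ⟨⊥, isSpanner_bot_of_subsingleton _ G w, ?_, ?_⟩⟩
    · rw [Nat.cast_zero]
      positivity
    · rw [SimpleGraph.edgeSet_bot, ncard_empty, Nat.cast_zero]
      positivity
    · simp [weightedEdges]
  · obtain ⟨s, q, h⟩ := exists_admissible hn (k := k) (by omega)
    obtain ⟨D, hD⟩ := exists_memory_decoder hn c (k * (9 * n * s)) q
    exact ⟨_, streamingAlgorithm D s q, h.words_le (by omega) hk,
      h.streamingAlgorithm_computesSpanners (by omega) hk hD⟩

end Main

end DistSpanner

theorem mainTheorem12 :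
    -- broadcast congested clique
    (∃ C : ℝ, ∀ c d : ℕ, ∃ b : ℕ, ∀ n k : ℕ, 1 ≤ k →
      ∃ (A : DistSpanner.BCCAlgorithm (b * Nat.clog 2 n)) (T : ℕ),
        (T : ℝ) ≤ C * (k * (n : ℝ) ^ (1 / (k : ℝ)) * Real.log n) ∧
        ∀ (G : SimpleGraph (Fin n)) (w : Sym2 (Fin n) → ℕ) (ident : Fin n → ℕ),
          (∀ e ∈ G.edgeSet, w e ≤ n ^ c) →
          Function.Injective ident → (∀ v, ident v < n ^ d) →
          ∃ H : SimpleGraph (Fin n),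
            DistSpanner.IsSpanner (2 * k - 1) G w H ∧
            (H.edgeSet.ncard : ℝ) ≤ C * (k * (n : ℝ) ^ (1 + 1 / (k : ℝ))) ∧
            ∀ v, A.output (A.run G w ident T v) = DistSpanner.identEdges H w ident) ∧
    -- multipass streaming
    (∃ C : ℝ, ∀ c : ℕ, ∃ b : ℕ, ∀ n k : ℕ, 1 ≤ k →
      ∃ (S : ℕ) (A : DistSpanner.StreamingAlgorithm n S (b * Nat.clog 2 n)),
        (S : ℝ) ≤ C * ((k + Real.log n) * (n : ℝ) ^ (1 + 1 / (k : ℝ))) ∧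
        ∀ (G : SimpleGraph (Fin n)) (w : Sym2 (Fin n) → ℕ) (stream : List (Sym2 (Fin n) × ℕ)),
          (∀ e ∈ G.edgeSet, w e ≤ n ^ c) →
          DistSpanner.IsEdgeStream G w stream →
          ∃ H : SimpleGraph (Fin n),
            DistSpanner.IsSpanner (2 * k - 1) G w H ∧
            (H.edgeSet.ncard : ℝ) ≤ C * (k * (n : ℝ) ^ (1 + 1 / (k : ℝ))) ∧
            A.output (A.run stream k) = DistSpanner.weightedEdges H w) := by
  exact ⟨⟨36, fun c d => ⟨c + d + 2, DistSpanner.exists_bccAlgorithm c d⟩⟩,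
    ⟨36, fun c => ⟨c + 4, DistSpanner.exists_streamingAlgorithm c⟩⟩⟩
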